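/- Let $\varepsilon>0$ and let $\mathcal G_\varepsilon\subset\mathbb R^2$ be the metric grid with vertex set $\varepsilon\mathbb Z^2$ and an edge of length $\varepsilon$ between any two vertices at distance $\varepsilon$. Let $H^1(\mathcal G_\varepsilon)$ be the space of continuous functions $u:\mathcal G_\varepsilon\to\mathbb R$ in $L^2(\mathcal G_\varepsilon)$ that have on the edges a weak derivative $u'$ in $L^2(\mathcal G_\varepsilon)$. Let $V\subset\varepsilon\mathbb Z^2$ be non-empty and $\mathbb Z^2$-periodic, i.e. $V=\varepsilon V'$ where $V'\subset\mathbb Z^2$ and there are linearly independent $\vec v_1,\vec v_2\in\mathbb Z^2$ with $V'=V'+k_1\vec v_1+k_2\vec v_2$ for all $k_1,k_2\in\mathbb Z$. Let $p\in(2,6)$, $q\in(2,4)$ and $\alpha,\beta>0$, and set $$E(u)=\frac12\|u'\|_{L^2(\mathcal G_\varepsilon)}^2-\frac{\alpha}{p}\|u\|_{L^p(\mathcal G_\varepsilon)}^p-\frac{\beta}{q}\sum_{v\in V}|u(v)|^q,\qquad \mathcal E(\mu)=\inf\{E(u):u\in H^1(\mathcal G_\varepsilon),\ \|u\|_{L^2(\mathcal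 G_\varepsilon)}^2=\mu\}.$$ Then for every $\mu>0$ one has $\mathcal E(\mu)<0$, and there exists a ground state of mass $\mu$, i.e. a function $u\in H^1(\mathcal G_\varepsilon)$ with $\|u\|_{L^2(\mathcal G_\varepsilon)}^2=\mu$ and $E(u)=\mathcal E(\mu)$. -/

import Mathlib

open MeasureTheory Set
open scoped ContDiff

noncomputable section

/-- The two-dimensional metric grid with edge length `ε`: the union of all the horizontal lines
`y = ε j` and of all the vertical lines `x = ε i` (`i j : ℤ`), with the topology of the plane. -/
abbrev Grid (ε : ℝ) : Type :=
  {x : ℝ × ℝ // (∃ j : ℤ, x.2 = ε * j) ∨ (∃ i : ℤ, x.1 = ε * i)}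

/-- The vertex `ε (i, j)` of the grid. -/
def gridVertex (ε : ℝ) (v : ℤ × ℤ) : Grid ε :=
  ⟨(ε * v.1, ε * v.2), Or.inl ⟨v.2, rfl⟩⟩

/-- Labels of the edges: `(false, i, j)` is the horizontal edge `ε (i, i + 1) × {ε j}`
and `(true, i, j)` is the vertical edge `{ε i} × ε (j, j + 1)`. -/
abbrev GridEdge : Type := Bool × ℤ × ℤ

/-- Arc length parametrization of an edge; the points of the open edge are those with
`0 < t < ε`, and `t = 0`, `t = ε` give its two end points. -/
def edgePoint (ε : ℝ) : GridEdge → ℝ → Grid ε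
  | (false, i, j), t => ⟨(ε * i + t, ε * j), Or.inl ⟨j, rfl⟩⟩
  | (true, i, j), t => ⟨(ε * i, ε * j + t), Or.inr ⟨i, rfl⟩⟩

/-- Arc length measure on the grid, in edge coordinates `(e, t)`: Lebesgue measure on `(0, ε)` on
each edge. Vertices are negligible, so that `∫ z, f z ∂(gridMeasure ε) = ∑ₑ ∫₀^ε f (e, t) dt`. -/
def gridMeasure (ε : ℝ) : Measure (GridEdge × ℝ) :=
  (Measure.count : Measure GridEdge).prod ((volume : Measure ℝ).restrict (Ioo 0 ε))

/-- A function on the grid read in edge coordinates: `(e, t) ↦ u_e(t)`. -/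
def onEdges (ε : ℝ) (u : Grid ε → ℝ) : GridEdge × ℝ → ℝ :=
  fun z => u (edgePoint ε z.1 z.2)

/-- On each edge, `g` is a weak derivative of `u` (integration by parts against smooth functions
with compact support in the open edge). -/
def IsWeakDeriv (ε : ℝ) (u : Grid ε → ℝ) (g : GridEdge × ℝ → ℝ) : Prop :=
  ∀ (e : GridEdge) (φ : ℝ → ℝ), ContDiff ℝ ∞ φ → HasCompactSupport φ → tsupport φ ⊆ Ioo 0 ε →
    ∫ t in Ioo 0 ε, u (edgePoint ε e t) * deriv φ t = - ∫ t in Ioo 0 ε, g (e, t) * φ t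

/-- The Sobolev space `H¹` of the grid: continuous functions in `L²` with a weak
derivative on the edges that is in `L²`. -/
structure IsGridH1 (ε : ℝ) (u : Grid ε → ℝ) : Prop where
  continuous : Continuous u
  memLp : MemLp (onEdges ε u) 2 (gridMeasure ε)
  exists_weakDeriv : ∃ g, MemLp g 2 (gridMeasure ε) ∧ IsWeakDeriv ε u g

open Classical in
/-- The derivative `u'` of a function in `H¹`, which is unique almost everywhere
(and `0` if `u` has no weak derivative in `L²`). -/
def gridDeriv (ε : ℝ) (u : Grid ε → ℝ) : GridEdge × ℝ → ℝ :=
  if h : ∃ g, MemLp g 2 (gridMeasure ε) ∧ IsWeakDeriv ε u g then h.choose else 0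

/-- The functions in `H¹` with mass `‖u‖²_{L²} = μ`. -/
def gridH1Mass (ε μ : ℝ) : Set (Grid ε → ℝ) :=
  {u | IsGridH1 ε u ∧ ∫ z, (onEdges ε u z) ^ 2 ∂(gridMeasure ε) = μ}

/-- The doubly nonlinear energy
`½ ‖u'‖²_{L²} - (α / p) ‖u‖^p_{L^p} - (β / q) ∑_{v ∈ V} |u(v)|^q`.
For `u` in `H¹` and `p, q ≥ 2` the integrals and the sum are all finite. -/
def gridEnergy (ε p q α β : ℝ) (V : Set (Grid ε)) (u : Grid ε → ℝ) : ℝ :=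
  1 / 2 * ∫ z, (gridDeriv ε u z) ^ 2 ∂(gridMeasure ε)
    - α / p * ∫ z, |onEdges ε u z| ^ p ∂(gridMeasure ε)
    - β / q * ∑' v : V, |u v| ^ q

/-- The ground state level: the infimum, in the extended reals, of the energy at mass `μ`. -/
def groundStateLevel (ε p q α β : ℝ) (V : Set (Grid ε)) (μ : ℝ) : EReal :=
  ⨅ u ∈ gridH1Mass ε μ, (gridEnergy ε p q α β V u : EReal)

/-- `u` is a ground state of mass `μ`: it has mass `μ` and its energy is the ground state level. -/
def IsGroundState (ε p q α β : ℝ) (V : Set (Grid ε)) (μ : ℝ) (u : Grid ε → ℝ) : Prop :=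
  u ∈ gridH1Mass ε μ ∧ (gridEnergy ε p q α β V u : EReal) = groundStateLevel ε p q α β V μ

/-- `ℤ²`-periodic subsets of `ℤ²`: invariant under the translations by the integer
combinations of two linearly independent integer vectors (for integer vectors, linear independence
over `ℤ` and over `ℝ` agree). -/
def IsZ2PeriodicLattice (W : Set (ℤ × ℤ)) : Prop :=
  ∃ v₁ v₂ : ℤ × ℤ, LinearIndependent ℤ ![v₁, v₂] ∧
    ∀ k₁ k₂ : ℤ, W = (fun w => w + k₁ • v₁ + k₂ • v₂) '' W

/-- `ℤ²`-periodic sets of vertices of the grid: `V = ε W` with `W ⊆ ℤ²` a `ℤ²`-periodic set. -/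
def IsZ2Periodic (ε : ℝ) (V : Set (Grid ε)) : Prop :=
  ∃ W : Set (ℤ × ℤ), IsZ2PeriodicLattice W ∧ V = gridVertex ε '' W

end

/-! Write `m` for the mass and `k = ‖u'‖²`. On every edge, `u²` is at most its average plus `∫
2|u||u'|`, whence `sup u² ≤ ε⁻¹ m + 2 √(m k)`. Summing the same bound over edges controls `∑
|u(v)|²` over the vertices. So at fixed mass the `p`-term grows at most like `k^((p-2)/4)` and the
vertex term like `k^(q/4)`. Since `p < 6` and `q < 4`, the kinetic term wins: the energy is bounded
below and `k` is bounded wherever the energy is nonpositive (`exists_kinetic_bound`,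
`exists_kinetic_le`).

Negativity comes from the two-dimensional growth of the grid. A tent of width `N` has mass `O(N²)`,
bounded kinetic term and, by periodicity, at least a multiple of `N²` vertices of `V` where it is at
least `1/2`. Normalised by a factor `c` of order at least `1/N`, its vertex term beats the kinetic
one by a factor of order at least `N^(4-q)` (`exists_pairEnergy_neg`).

For existence, let `I < 0` be the infimum. If all edge masses were small, the sup norm would be
small and the energy could not stay near `I`; hence some edge carries a fixed mass
(`exists_edge_mass_lower_bound`). Translating by periods brings that edge into a finite box, so the
limit `U` of a minimizing subsequence is nonzero. Mass and energy split between `U` and the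
remainder (`tendsto_pairEnergy_sub`). Scaling up to mass `μ` shows that a function of mass `m ≤ μ`
has energy at least `(m/μ) I`, strictly if `0 < m < μ` (`mass_mul_le_pairEnergy`). Applied to the
remainder, this gives `E(U) ≤ (m(U)/μ) I`; applied to `U`, it forces `m(U) = μ`, so `U` is a
minimizer. -/

/-! ### Weak derivatives and primitives on an interval. -/

/-- A smooth function with compact support in an open interval and vanishing integral has a
primitive with the same properties. -/
theorem exists_primitive_of_integral_eq_zero {a b : ℝ} {η : ℝ → ℝ} (hη : ContDiff ℝ ∞ η)
    (hc : HasCompactSupport η) (hs : tsupport η ⊆ Ioo a b) (h0 : ∫ t, η t = 0) :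
    ∃ Φ : ℝ → ℝ, ContDiff ℝ ∞ Φ ∧ HasCompactSupport Φ ∧ tsupport Φ ⊆ Ioo a b ∧ deriv Φ = η := by
  rcases (tsupport η).eq_empty_or_nonempty with he | hne
  · have : η = 0 := tsupport_eq_empty_iff.mp he
    subst this
    exact ⟨0, contDiff_const, HasCompactSupport.zero, by simp [tsupport_zero],
      by ext; simp⟩
  obtain ⟨c, hcm, hcl⟩ := hc.isCompact.exists_isLeast hne
  obtain ⟨d, hdm, hdl⟩ := hc.isCompact.exists_isGreatest hne
  have hz : ∀ t, t ∉ Icc c d → η t = 0 := fun t ht => by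
    by_contra h
    exact ht ⟨hcl (subset_tsupport _ h), hdl (subset_tsupport _ h)⟩
  have hη' := hη.continuous
  have hcd : c ≤ d := hcl hdm
  have hder : ∀ t, HasDerivAt (fun x => ∫ s in c..x, η s) (η t) t := fun t =>
    intervalIntegral.integral_hasDerivAt_right (hη'.intervalIntegrable _ _)
      (hη'.stronglyMeasurableAtFilter _ _) hη'.continuousAt
  have hderiv : deriv (fun x => ∫ s in c..x, η s) = η := funext fun t => (hder t).deriv
  have hint : ∫ s in c..d, η s = 0 := by
    rw [intervalIntegral.integral_of_le hcd, ← integral_Icc_eq_integral_Ioc,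
      setIntegral_eq_integral_of_forall_compl_eq_zero hz, h0]
  -- Left of `c` the integrand vanishes; right of `d` the primitive equals the total integral, which
  -- is zero.
  have hsupp : Function.support (fun x => ∫ s in c..x, η s) ⊆ Icc c d := by
    intro t ht
    by_contra hn
    apply ht
    simp only [mem_Icc, not_and_or, not_le] at hn
    rcases hn with h | h
    · refine intervalIntegral.integral_zero_ae ?_
      filter_upwards [Measure.ae_ne volume c] with s hsc hs
      exact hz s fun h' => hsc (le_antisymm (uIoc_of_ge h.le ▸ hs).2 h'.1)
    · have : ∫ s in c..t, η s = (∫ s in c..d, η s) + ∫ s in d..t, η s :=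
        (intervalIntegral.integral_add_adjacent_intervals (hη'.intervalIntegrable _ _)
          (hη'.intervalIntegrable _ _)).symm
      simp only [this, hint, zero_add]
      refine intervalIntegral.integral_zero_ae (Filter.Eventually.of_forall fun s hs => hz s ?_)
      intro h'
      exact absurd h'.2 (not_le.2 (uIoc_of_le h.le ▸ hs).1)
  have hts : tsupport (fun x => ∫ s in c..x, η s) ⊆ Icc c d := closure_minimal hsupp isClosed_Icc
  refine ⟨_, ?_, HasCompactSupport.of_support_subset_isCompact isCompact_Icc hsupp,
    hts.trans fun t ht => ⟨(hs hcm).1.trans_le ht.1, ht.2.trans_lt (hs hdm).2⟩, hderiv⟩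
  exact contDiff_infty_iff_deriv.2 ⟨fun t => (hder t).differentiableAt, by rwa [hderiv]⟩

/-- **Du Bois-Reymond lemma**: a continuous function with zero weak derivative is constant. -/
theorem eqOn_const_of_integral_mul_deriv_eq_zero {a b : ℝ} (hab : a < b) {v : ℝ → ℝ}
    (hv : ContinuousOn v (Icc a b))
    (h : ∀ φ : ℝ → ℝ, ContDiff ℝ ∞ φ → HasCompactSupport φ → tsupport φ ⊆ Ioo a b →
      ∫ t in Ioo a b, v t * deriv φ t = 0) :
    ∀ t ∈ Icc a b, v t = v a := by
  have hsm : ∀ (φ : ℝ → ℝ), Continuous φ → IntegrableOn (fun t => v t * φ t) (Ioo a b) :=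
    fun φ hφ => ((hv.mul hφ.continuousOn).integrableOn_compact isCompact_Icc).mono_set
      Ioo_subset_Icc_self
  have hset : ∀ φ : ℝ → ℝ, tsupport φ ⊆ Ioo a b → ∫ t in Ioo a b, φ t = ∫ t, φ t := fun φ hφ =>
    setIntegral_eq_integral_of_forall_compl_eq_zero fun t ht => by
      by_contra h'
      exact ht (hφ (subset_tsupport _ h'))
  set ψ : ContDiffBump ((a + b) / 2) := ⟨(b - a) / 8, (b - a) / 4, by linarith, by linarith⟩
  set ρ : ℝ → ℝ := ψ.normed volume
  have hρs : tsupport ρ ⊆ Ioo a b := by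
    rw [ContDiffBump.tsupport_normed_eq]
    intro t ht
    rw [Metric.mem_closedBall, Real.dist_eq, abs_le] at ht
    constructor <;> simp only [ψ] at ht <;> linarith [ht.1, ht.2]
  have hρc : HasCompactSupport ρ := ψ.hasCompactSupport_normed
  have hρd : ContDiff ℝ ∞ ρ := ψ.contDiff_normed
  have hρi : ∫ t, ρ t = 1 := ψ.integral_normed
  -- The candidate constant is the `ρ`-average of `v`. For a test function `φ`, the difference `φ -
  -- (∫ φ) ρ` has zero mean, hence is the derivative of a test function.
  set c := ∫ t in Ioo a b, v t * ρ t
  have key : ∀ᵐ t, t ∈ Ioo a b → v t - c = 0 := by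
    refine isOpen_Ioo.ae_eq_zero_of_integral_contDiff_smul_eq_zero
      (((hv.sub continuousOn_const).mono Ioo_subset_Icc_self).locallyIntegrableOn
        measurableSet_Ioo) fun φ hφ hφc hφs => ?_
    have hηs : tsupport (fun t => φ t - (∫ s, φ s) * ρ t) ⊆ Ioo a b := by
      refine (closure_mono (t := Function.support φ ∪ Function.support ρ) fun t ht => ?_).trans
        (closure_union.trans_subset (union_subset hφs hρs))
      by_contra h'
      simp only [mem_union, Function.mem_support, not_or, not_not] at h'
      exact ht (by simp [h'.1, h'.2])
    have hη0 : ∫ t, (φ t - (∫ s, φ s) * ρ t) = 0 := by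
      rw [integral_sub (hφ.continuous.integrable_of_hasCompactSupport hφc)
        ((hρd.continuous.integrable_of_hasCompactSupport hρc).const_mul _), integral_const_mul,
        hρi]; ring
    obtain ⟨Φ, h1, h2, h3, h4⟩ := exists_primitive_of_integral_eq_zero
      (hφ.sub (contDiff_const.mul hρd)) (hφc.sub (hρc.mul_left)) hηs hη0
    have := h Φ h1 h2 h3
    rw [h4] at this
    have e1 : ∫ t, φ t • (v t - c) = ∫ t in Ioo a b, φ t • (v t - c) := by
      rw [hset]
      refine (closure_mono ?_).trans hφs
      exact Function.support_smul_subset_left φ (fun t => v t - c)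
    rw [e1]
    simp only [mul_sub, smul_eq_mul] at this ⊢
    rw [integral_sub (hsm _ hφ.continuous)
      (hsm (fun t => (∫ s, φ s) * ρ t) (continuous_const.mul hρd.continuous))] at this
    have e2 : ∫ t in Ioo a b, v t * ((∫ s, φ s) * ρ t) = (∫ s, φ s) * c := by
      rw [← integral_const_mul]; congr 1; ext t; ring
    rw [integral_sub, integral_mul_const, hset φ hφs]
    · simp_rw [mul_comm (φ _)]
      rw [e2] at this; exact this
    · simpa only [IntegrableOn, mul_comm] using hsm _ hφ.continuous
    · exact (hφ.continuous.integrable_of_hasCompactSupport hφc).integrableOn.mul_const _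
  have hIoo : EqOn v (fun _ => c) (Ioo a b) := by
    refine Measure.eqOn_open_of_ae_eq (μ := volume) ?_ isOpen_Ioo (hv.mono Ioo_subset_Icc_self) continuousOn_const
    rw [Filter.EventuallyEq, ae_restrict_iff' measurableSet_Ioo]
    filter_upwards [key] with t ht h using sub_eq_zero.1 (ht h)
  have hIcc : EqOn v (fun _ => c) (Icc a b) :=
    hIoo.of_subset_closure hv continuousOn_const Ioo_subset_Icc_self (closure_Ioo hab.ne).ge
  exact fun t ht => (hIcc ht).trans (hIcc (left_mem_Icc.2 hab.le)).symm

/-- Integration by parts of a primitive against a test function. -/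
theorem integral_mul_deriv_of_primitive {a b : ℝ} (hab : a < b) {v g φ : ℝ → ℝ}
    (hg : IntegrableOn g (Ioo a b)) (hv : ∀ t ∈ Icc a b, v t = v a + ∫ s in a..t, g s)
    (hφ : ContDiff ℝ ∞ φ) (hs : tsupport φ ⊆ Ioo a b) :
    ∫ t in Ioo a b, v t * deriv φ t = - ∫ t in Ioo a b, g t * φ t := by
  have hgi : IntervalIntegrable g volume a b := by
    rwa [intervalIntegrable_iff_integrableOn_Ioo_of_le hab.le]
  have h0 : ∀ t, t ∉ Ioo a b → φ t = 0 := fun t ht => by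
    by_contra h
    exact ht (hs (subset_tsupport _ h))
  -- `v` is a primitive only on `[a, b]`; `G` agrees with it there and is globally given by the
  -- formula, so it can be differentiated almost everywhere.
  set G : ℝ → ℝ := fun t => v a + ∫ s in a..t, g s
  have hac : AbsolutelyContinuousOnInterval G a b := by
    have := hgi.absolutelyContinuousOnInterval_intervalIntegral (c := a) left_mem_uIcc
    have hc : AbsolutelyContinuousOnInterval (fun _ : ℝ => v a) a b :=
      (contDiffOn_const).absolutelyContinuousOnInterval
    exact hc.fun_add this
  have hφac : AbsolutelyContinuousOnInterval φ a b :=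
    ((hφ.of_le (by norm_cast)).contDiffOn).absolutelyContinuousOnInterval
  have := hac.integral_mul_deriv_eq_deriv_mul hφac
  rw [h0 a (by simp), h0 b (by simp), mul_zero, mul_zero, sub_zero, zero_sub] at this
  rw [← integral_Ioc_eq_integral_Ioo, ← integral_Ioc_eq_integral_Ioo,
    ← intervalIntegral.integral_of_le hab.le, ← intervalIntegral.integral_of_le hab.le]
  rw [intervalIntegral.integral_congr (g := fun t => G t * deriv φ t)
    (fun t ht => by simp only [G]; rw [← hv t (by rwa [uIcc_of_le hab.le] at ht)]), this]
  congr 1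
  refine intervalIntegral.integral_congr_ae ?_
  filter_upwards [hgi.ae_hasDerivAt_integral] with t ht h
  have := ((ht (uIoc_subset_uIcc h) a left_mem_uIcc).const_add (v a)).deriv
  rw [this]

/-- A continuous function with an integrable weak derivative is a primitive of it. -/
theorem eq_primitive_of_integral_mul_deriv {a b : ℝ} (hab : a < b) {v g : ℝ → ℝ}
    (hg : IntegrableOn g (Ioo a b)) (hv : ContinuousOn v (Icc a b))
    (h : ∀ φ : ℝ → ℝ, ContDiff ℝ ∞ φ → HasCompactSupport φ → tsupport φ ⊆ Ioo a b →
      ∫ t in Ioo a b, v t * deriv φ t = - ∫ t in Ioo a b, g t * φ t) :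
    ∀ t ∈ Icc a b, v t = v a + ∫ s in a..t, g s := by
  have hgi : IntervalIntegrable g volume a b := by
    rwa [intervalIntegrable_iff_integrableOn_Ioo_of_le hab.le]
  have hGc : ContinuousOn (fun t => ∫ s in a..t, g s) (Icc a b) := by
    have := hgi.absolutelyContinuousOnInterval_intervalIntegral (c := a) left_mem_uIcc
    simpa [uIcc_of_le hab.le] using this.continuousOn
  have := eqOn_const_of_integral_mul_deriv_eq_zero hab (hv.sub hGc) fun φ h1 h2 h3 => ?_
  · intro t ht
    have := this t ht
    simp only [Pi.sub_apply, intervalIntegral.integral_same, sub_zero] at this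
    linarith
  · have hd : Continuous (deriv φ) := h1.continuous_deriv (by norm_cast)
    have hsm : ∀ w : ℝ → ℝ, ContinuousOn w (Icc a b) →
        IntegrableOn (fun t => w t * deriv φ t) (Ioo a b) :=
      fun w hw => ((hw.mul hd.continuousOn).integrableOn_compact isCompact_Icc).mono_set
        Ioo_subset_Icc_self
    simp only [Pi.sub_apply, sub_mul]
    rw [integral_sub (hsm _ hv) (hsm _ hGc), h φ h1 h2 h3,
      integral_mul_deriv_of_primitive hab hg (v := fun t => ∫ s in a..t, g s) (by simp) h1 h3]
    ring

/-- Bound of the increments of the square of a primitive. -/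
theorem abs_sq_sub_sq_le_of_primitive {a b : ℝ} (hab : a < b) {v g : ℝ → ℝ}
    (hg : IntegrableOn g (Ioo a b))
    (hv : ∀ t ∈ Icc a b, v t = v a + ∫ s in a..t, g s) {s t : ℝ} (hs : s ∈ Icc a b)
    (ht : t ∈ Icc a b) :
    |v t ^ 2 - v s ^ 2| ≤ ∫ r in Ioo a b, 2 * (|v r| * |g r|) := by
  have hgi : IntervalIntegrable g volume a b := by
    rwa [intervalIntegrable_iff_integrableOn_Ioo_of_le hab.le]
  set G : ℝ → ℝ := fun t => v a + ∫ s in a..t, g s with hGdef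
  have hac : AbsolutelyContinuousOnInterval G a b := by
    have := hgi.absolutelyContinuousOnInterval_intervalIntegral (c := a) left_mem_uIcc
    have hc : AbsolutelyContinuousOnInterval (fun _ : ℝ => v a) a b :=
      (contDiffOn_const).absolutelyContinuousOnInterval
    exact hc.fun_add this
  have hst : uIcc s t ⊆ uIcc a b := by
    rw [uIcc_of_le hab.le]; exact uIcc_subset_Icc hs ht
  have hac' := hac.mono hst
  have h1 := AbsolutelyContinuousOnInterval.integral_deriv_mul_eq_sub hac' hac'
  have h2 : ∫ x in s..t, deriv G x * G x + G x * deriv G x = ∫ x in s..t, 2 * (G x * g x) := by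
    refine intervalIntegral.integral_congr_ae ?_
    filter_upwards [hgi.ae_hasDerivAt_integral] with x hx h
    have := ((hx (hst (uIoc_subset_uIcc h)) a left_mem_uIcc).const_add (v a)).deriv
    rw [hGdef, this]; ring
  have hint : IntegrableOn (fun x => 2 * (|G x| * |g x|)) (Ioc a b) := by
    have hc := hac.continuousOn
    rw [uIcc_of_le hab.le] at hc
    have : IntervalIntegrable (fun x => |G x| * |g x|) volume a b :=
      hgi.abs.continuousOn_mul (by rw [uIcc_of_le hab.le]; exact hc.abs)
    exact ((intervalIntegrable_iff_integrableOn_Ioc_of_le hab.le).1 this).const_mul 2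
  have e : v t ^ 2 - v s ^ 2 = ∫ x in s..t, 2 * (G x * g x) := by
    rw [← h2, h1, hv t ht, hv s hs]; ring
  have e2 : ∫ r in Ioo a b, 2 * (|v r| * |g r|) = ∫ r in Ioc a b, 2 * (|G r| * |g r|) := by
    rw [integral_Ioc_eq_integral_Ioo]
    refine setIntegral_congr_fun measurableSet_Ioo fun r hr => ?_
    simp only [hGdef]; rw [← hv r (Ioo_subset_Icc_self hr)]
  rw [e, e2, ← Real.norm_eq_abs]
  refine (intervalIntegral.norm_integral_le_integral_norm_uIoc).trans ?_
  simp only [norm_mul, Real.norm_eq_abs, Nat.abs_ofNat]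
  refine setIntegral_mono_set hint (Filter.Eventually.of_forall fun x => by positivity) ?_
  refine LE.le.eventuallyLE ?_
  rw [← uIoc_of_le hab.le]
  intro x hx
  rcases le_total s t with h | h
  · rw [uIoc_of_le h] at hx; rw [uIoc_of_le hab.le]
    exact ⟨hs.1.trans_lt hx.1, hx.2.trans ht.2⟩
  · rw [uIoc_of_ge h] at hx; rw [uIoc_of_le hab.le]
    exact ⟨ht.1.trans_lt hx.1, hx.2.trans hs.2⟩

/-- Pointwise bound of a primitive in terms of its square integral on the interval. -/
theorem sq_le_of_primitive {a b : ℝ} (hab : a < b) {v g : ℝ → ℝ}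
    (hg : IntegrableOn g (Ioo a b))
    (hv : ∀ t ∈ Icc a b, v t = v a + ∫ s in a..t, g s) {t : ℝ} (ht : t ∈ Icc a b) :
    v t ^ 2 ≤ (b - a)⁻¹ * (∫ s in Ioo a b, v s ^ 2) + ∫ s in Ioo a b, 2 * (|v s| * |g s|) := by
  have hgi : IntervalIntegrable g volume a b := by
    rwa [intervalIntegrable_iff_integrableOn_Ioo_of_le hab.le]
  have hvc : ContinuousOn v (Icc a b) := by
    have := (hgi.absolutelyContinuousOnInterval_intervalIntegral (c := a) left_mem_uIcc).continuousOn
    rw [uIcc_of_le hab.le] at this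
    exact (continuousOn_const.add this).congr hv
  have hvi : IntegrableOn (fun s => v s ^ 2) (Ioo a b) :=
    ((hvc.pow 2).integrableOn_compact isCompact_Icc).mono_set Ioo_subset_Icc_self
  set K := ∫ s in Ioo a b, 2 * (|v s| * |g s|)
  -- The increment bound `v t ^ 2 - K ≤ v s ^ 2` is averaged over the base point `s`.
  have h : ∫ s in Ioo a b, (v t ^ 2 - K) ≤ ∫ s in Ioo a b, v s ^ 2 := by
    refine setIntegral_mono_on (integrableOn_const (by simp)) hvi measurableSet_Ioo fun s hs => ?_
    have := (abs_le.1 (abs_sq_sub_sq_le_of_primitive hab hg hv (Ioo_subset_Icc_self hs) ht)).2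
    linarith
  rw [setIntegral_const, smul_eq_mul, Measure.real, Real.volume_Ioo,
    ENNReal.toReal_ofReal (by linarith)] at h
  have hb : 0 < b - a := by linarith
  have := mul_le_mul_of_nonneg_left h (inv_nonneg.2 hb.le)
  rw [← mul_assoc, inv_mul_cancel₀ hb.ne', one_mul] at this
  linarith

/-! ### Elementary inequalities for `|x| ^ r`. -/

/-- Local Lipschitz bound for `|x| ^ r`. -/
theorem abs_abs_rpow_sub_abs_rpow_le {r R x y : ℝ} (hr : 1 < r) (hx : |x| ≤ R) (hy : |y| ≤ R) :
    |(|x| ^ r - |y| ^ r)| ≤ r * R ^ (r - 1) * |x - y| := by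
  have hR : 0 ≤ R := (abs_nonneg x).trans hx
  have := Convex.norm_image_sub_le_of_norm_hasDerivWithin_le (𝕜 := ℝ) (s := Icc (-R) R)
    (f := fun x : ℝ => |x| ^ r) (C := r * R ^ (r - 1)) (x := y) (y := x)
    (fun z _ => (hasDerivAt_abs_rpow z hr).hasDerivWithinAt) (fun z hz => ?_) (convex_Icc _ _)
    (abs_le.1 hy) (abs_le.1 hx)
  · simpa using this
  · have hz' : |z| ≤ R := abs_le.2 hz
    rw [norm_mul, norm_mul, Real.norm_eq_abs, Real.norm_eq_abs, Real.norm_eq_abs,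
      abs_of_pos (by linarith : 0 < r), abs_of_nonneg (Real.rpow_nonneg (abs_nonneg z) _), mul_assoc]
    refine mul_le_mul_of_nonneg_left ?_ (by linarith)
    rcases eq_or_ne z 0 with rfl | h0
    · simpa using Real.rpow_nonneg hR _
    · have : |z| ^ (r - 2) * |z| = |z| ^ (r - 1) := by
        rw [← Real.rpow_add_one (abs_ne_zero.2 h0)]; ring_nf
      rw [this]
      exact Real.rpow_le_rpow (abs_nonneg _) hz' (by linarith)

/-- For bounded arguments the defect of additivity of `|x| ^ r` is controlled by the product. -/
theorem abs_abs_rpow_add_sub_le {r M a b : ℝ} (hr : 2 ≤ r) (ha : |a| ≤ M) (hb : |b| ≤ M) :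
    |(|a + b| ^ r - |a| ^ r - |b| ^ r)| ≤ (r * 2 ^ (r - 1) + 1) * M ^ (r - 2) * (|a| * |b|) := by
  -- With `b` the smaller term, `|a + b| ^ r - |a| ^ r` (Lipschitz bound at radius `2|a|`) and `|b|
  -- ^ r` are separately of order `M ^ (r - 2) |a| |b|`.
  wlog hab : |b| ≤ |a| generalizing a b
  · have := this hb ha (le_of_not_ge hab)
    rw [add_comm b a, mul_comm |b|] at this
    rwa [sub_right_comm] at this
  have h1 : |(|a + b| ^ r - |a| ^ r)| ≤ r * (2 * |a|) ^ (r - 1) * |b| := by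
    have := abs_abs_rpow_sub_abs_rpow_le (r := r) (R := 2 * |a|) (x := a + b) (y := a)
      (by linarith) ((abs_add_le a b).trans (by linarith)) (by linarith [abs_nonneg a])
    simpa using this
  have hpow : ∀ x : ℝ, |x| ≤ M → |x| ^ (r - 1) ≤ M ^ (r - 2) * |x| := fun x hx => by
    rcases eq_or_ne x 0 with rfl | h0
    · rw [abs_zero, Real.zero_rpow (by linarith), mul_zero]
    · rw [show r - 1 = (r - 2) + 1 by ring, Real.rpow_add_one (abs_ne_zero.2 h0)]
      exact mul_le_mul_of_nonneg_right (Real.rpow_le_rpow (abs_nonneg _) hx (by linarith))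
        (abs_nonneg _)
  have h2 : |b| ^ r ≤ M ^ (r - 2) * (|a| * |b|) := by
    rcases eq_or_ne b 0 with rfl | h0
    · rw [abs_zero, Real.zero_rpow (by linarith)]; simp
    · rw [show r = (r - 1) + 1 by ring, Real.rpow_add_one (abs_ne_zero.2 h0), ← mul_assoc,
        show r - 1 + 1 - 2 = r - 2 by ring]
      exact mul_le_mul_of_nonneg_right ((hpow b hb).trans (mul_le_mul_of_nonneg_left hab
        (Real.rpow_nonneg ((abs_nonneg _).trans ha) _))) (abs_nonneg _)
  have h3 : r * (2 * |a|) ^ (r - 1) * |b| ≤ r * 2 ^ (r - 1) * M ^ (r - 2) * (|a| * |b|) := by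
    rw [Real.mul_rpow zero_le_two (abs_nonneg a)]
    have := mul_le_mul_of_nonneg_left (hpow a ha)
      (show 0 ≤ r * 2 ^ (r - 1) * |b| by positivity)
    linarith
  have h4 : 0 ≤ |b| ^ r := by positivity
  calc |(|a + b| ^ r - |a| ^ r - |b| ^ r)| ≤ |(|a + b| ^ r - |a| ^ r)| + |(|b| ^ r)| := abs_sub _ _
    _ ≤ _ := by rw [abs_of_nonneg h4]; linarith

/-! ### Square integrable functions: Brezis–Lieb splitting and weak compactness. -/

section Measure

variable {X : Type*} [MeasurableSpace X] {ν : Measure X}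

/-- A bounded square integrable function is `r`-integrable for `r ≥ 2`. -/
theorem MeasureTheory.MemLp.integrable_abs_rpow_of_bound {f : X → ℝ} {r M : ℝ} (hf : MemLp f 2 ν)
    (hM : ∀ᵐ x ∂ν, |f x| ≤ M) (hr : 2 ≤ r) :
    Integrable (fun x => |f x| ^ r) ν ∧ ∫ x, |f x| ^ r ∂ν ≤ M ^ (r - 2) * ∫ x, f x ^ 2 ∂ν := by
  have hle : ∀ᵐ x ∂ν, |f x| ^ r ≤ M ^ (r - 2) * f x ^ 2 := by
    filter_upwards [hM] with x hx
    rcases eq_or_ne (f x) 0 with h0 | h0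
    · rw [h0, abs_zero, Real.zero_rpow (by linarith)]; simp
    · have : |f x| ^ r = |f x| ^ (r - 2) * f x ^ 2 := by
        rw [← sq_abs (f x), ← Real.rpow_add_natCast (abs_ne_zero.2 h0)]; simp
      rw [this]
      exact mul_le_mul_of_nonneg_right (Real.rpow_le_rpow (abs_nonneg _) hx (by linarith))
        (sq_nonneg _)
  have hi : Integrable (fun x => M ^ (r - 2) * f x ^ 2) ν := hf.integrable_sq.const_mul _
  have hI : Integrable (fun x => |f x| ^ r) ν := by
    refine hi.mono' ?_ ?_
    · have : Continuous fun x : ℝ => |x| ^ r :=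
        continuous_abs.rpow_const fun _ => Or.inr (by linarith)
      exact this.comp_aestronglyMeasurable hf.1
    · filter_upwards [hle] with x hx
      rwa [Real.norm_of_nonneg (by positivity)]
  refine ⟨hI, ?_⟩
  rw [← integral_const_mul]
  exact integral_mono_ae hI hi hle

/-- Cauchy–Schwarz for real square integrable functions. -/
theorem integral_abs_mul_abs_le_sqrt {f g : X → ℝ} (hf : MemLp f 2 ν) (hg : MemLp g 2 ν) :
    ∫ x, |f x| * |g x| ∂ν ≤ √((∫ x, f x ^ 2 ∂ν) * ∫ x, g x ^ 2 ∂ν) := by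
  have h := integral_mul_le_Lp_mul_Lq_of_nonneg (μ := ν) (f := fun x => |f x|)
    (g := fun x => |g x|) Real.HolderConjugate.two_two
    (Filter.Eventually.of_forall fun _ => abs_nonneg _)
    (Filter.Eventually.of_forall fun _ => abs_nonneg _) (by rw [ENNReal.ofReal_ofNat]; exact hf.abs)
    (by rw [ENNReal.ofReal_ofNat]; exact hg.abs)
  rw [Real.sqrt_mul (integral_nonneg fun _ => sq_nonneg _), Real.sqrt_eq_rpow, Real.sqrt_eq_rpow]
  simpa using h

/-- If `f ∈ L²` and `w n` is bounded in `L²` and tends to zero almost everywhere, then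
`∫ |f| |w n|` tends to zero. -/
theorem tendsto_integral_abs_mul_abs_zero {f : X → ℝ} {w : ℕ → X → ℝ} {K : ℝ}
    (hf : MemLp f 2 ν) (hw : ∀ n, MemLp (w n) 2 ν) (hK : ∀ n, ∫ x, w n x ^ 2 ∂ν ≤ K)
    (hlim : ∀ᵐ x ∂ν, Filter.Tendsto (fun n => w n x) Filter.atTop (nhds 0)) :
    Filter.Tendsto (fun n => ∫ x, |f x| * |w n x| ∂ν) Filter.atTop (nhds 0) := by
  have hK0 : 0 ≤ K := (integral_nonneg fun _ => sq_nonneg _).trans (hK 0)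
  have hint : ∀ n, Integrable (fun x => |f x| * |w n x|) ν := fun n => hf.abs.integrable_mul (hw n).abs
  rw [Metric.tendsto_atTop]
  intro δ hδ
  -- Truncation at `|w n| ≤ A |f|`: the truncated product is dominated by `A f²`, and where `|w n| >
  -- A |f|` the product is below `A⁻¹ (w n)²`, whose integral is at most `K / A < δ / 2`.
  set A : ℝ := 2 * (K + 1) / δ with hA
  have hA0 : 0 < A := by positivity
  have hmin : Filter.Tendsto (fun n => ∫ x, |f x| * min |w n x| (A * |f x|) ∂ν) Filter.atTop
      (nhds (∫ _, (0 : ℝ) ∂ν)) := by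
    refine tendsto_integral_of_dominated_convergence (fun x => A * f x ^ 2) (fun n => ?_)
      (hf.integrable_sq.const_mul A) (fun n => ?_) ?_
    · exact hf.abs.1.mul ((hw n).abs.1.inf (hf.abs.1.const_mul A))
    · refine Filter.Eventually.of_forall fun x => ?_
      rw [Real.norm_of_nonneg (by positivity)]
      calc |f x| * min |w n x| (A * |f x|) ≤ |f x| * (A * |f x|) := by gcongr; exact min_le_right _ _
        _ = A * f x ^ 2 := by rw [← sq_abs]; ring
    · filter_upwards [hlim] with x hx
      have h1 : Filter.Tendsto (fun n => |f x| * |w n x|) Filter.atTop (nhds 0) := by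
        simpa using (hx.abs.const_mul |f x|)
      refine squeeze_zero (fun n => by positivity) (fun n => ?_) h1
      gcongr; exact min_le_left _ _
  rw [integral_zero] at hmin
  obtain ⟨N, hN⟩ := (Metric.tendsto_atTop.1 hmin) (δ / 2) (by positivity)
  refine ⟨N, fun n hn => ?_⟩
  have h1 := hN n hn
  rw [Real.dist_0_eq_abs] at h1 ⊢
  rw [abs_of_nonneg (integral_nonneg fun _ => by positivity)] at h1 ⊢
  have hmi : Integrable (fun x => |f x| * min |w n x| (A * |f x|)) ν := by
    refine (hint n).mono' (hf.abs.1.mul ((hw n).abs.1.inf (hf.abs.1.const_mul A)))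
      (Filter.Eventually.of_forall fun x => ?_)
    rw [Real.norm_of_nonneg (by positivity)]
    gcongr; exact min_le_left _ _
  have h2 : ∫ x, |f x| * |w n x| ∂ν ≤
      ∫ x, (|f x| * min |w n x| (A * |f x|) + A⁻¹ * w n x ^ 2) ∂ν := by
    refine integral_mono (hint n) (hmi.add ((hw n).integrable_sq.const_mul _)) fun x => ?_
    show |f x| * |w n x| ≤ |f x| * min |w n x| (A * |f x|) + A⁻¹ * w n x ^ 2
    rcases le_total |w n x| (A * |f x|) with h | h
    · rw [min_eq_left h]; have : 0 ≤ A⁻¹ * w n x ^ 2 := by positivity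
      linarith
    · have h3 : 0 ≤ |f x| * min |w n x| (A * |f x|) := by positivity
      have h4 : |f x| ≤ A⁻¹ * |w n x| := by rwa [le_inv_mul_iff₀ hA0]
      have := mul_le_mul_of_nonneg_right h4 (abs_nonneg (w n x))
      rw [mul_assoc, ← sq, sq_abs] at this
      linarith
  rw [integral_add hmi ((hw n).integrable_sq.const_mul _), integral_const_mul] at h2
  have h3 : A⁻¹ * ∫ x, w n x ^ 2 ∂ν < δ / 2 := by
    rw [inv_mul_lt_iff₀ hA0, hA]
    have : 2 * (K + 1) / δ * (δ / 2) = K + 1 := by field_simp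
    rw [this]; linarith [hK n]
  linarith

/-- **Brezis–Lieb splitting** for bounded functions. -/
theorem tendsto_integral_abs_rpow_add_sub {f : X → ℝ} {w : ℕ → X → ℝ} {K M r : ℝ} (hr : 2 ≤ r)
    (hf : MemLp f 2 ν) (hw : ∀ n, MemLp (w n) 2 ν) (hK : ∀ n, ∫ x, w n x ^ 2 ∂ν ≤ K)
    (hlim : ∀ᵐ x ∂ν, Filter.Tendsto (fun n => w n x) Filter.atTop (nhds 0))
    (hfM : ∀ᵐ x ∂ν, |f x| ≤ M) (hwM : ∀ n, ∀ᵐ x ∂ν, |w n x| ≤ M) :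
    Filter.Tendsto (fun n => ∫ x, |f x + w n x| ^ r ∂ν - ∫ x, |f x| ^ r ∂ν - ∫ x, |w n x| ^ r ∂ν)
      Filter.atTop (nhds 0) := by
  -- Thanks to the uniform bound `M`, the pointwise defect is at most a constant times `|f| |w n|`.
  have h := (tendsto_integral_abs_mul_abs_zero hf hw hK hlim).const_mul
    ((r * 2 ^ (r - 1) + 1) * M ^ (r - 2))
  rw [mul_zero] at h
  refine squeeze_zero_norm (fun n => ?_) h
  have i1 : Integrable (fun x => |f x + w n x| ^ r) ν :=
    ((hf.add (hw n)).integrable_abs_rpow_of_bound (M := M + M) (by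
      filter_upwards [hfM, hwM n] with x h1 h2
      exact (abs_add_le _ _).trans (add_le_add h1 h2)) hr).1
  have i2 := (hf.integrable_abs_rpow_of_bound hfM hr).1
  have i3 := ((hw n).integrable_abs_rpow_of_bound (hwM n) hr).1
  rw [← integral_sub i1 i2, ← integral_sub (f := fun x => |f x + w n x| ^ r - |f x| ^ r) (i1.sub i2) i3, ← integral_const_mul]
  refine norm_integral_le_of_norm_le ((hf.abs.integrable_mul (hw n).abs).const_mul _) ?_
  filter_upwards [hfM, hwM n] with x h1 h2
  exact abs_abs_rpow_add_sub_le hr h1 h2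

/-- Almost everywhere limits of bounded sequences of `L²` are in `L²`. -/
theorem memLp_two_of_tendsto {f : X → ℝ} {w : ℕ → X → ℝ} {K : ℝ} (hw : ∀ n, MemLp (w n) 2 ν)
    (hK : ∀ n, ∫ x, w n x ^ 2 ∂ν ≤ K)
    (hlim : ∀ᵐ x ∂ν, Filter.Tendsto (fun n => w n x) Filter.atTop (nhds (f x))) :
    MemLp f 2 ν := by
  refine ⟨aestronglyMeasurable_of_tendsto_ae Filter.atTop (fun n => (hw n).1) hlim, ?_⟩
  refine (Lp.eLpNorm_le_of_ae_tendsto (C := ENNReal.ofReal (K ^ (2⁻¹ : ℝ)))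
    (Filter.Eventually.of_forall fun n => ?_) (fun n => (hw n).1) hlim).trans_lt ENNReal.ofReal_lt_top
  rw [(hw n).eLpNorm_eq_integral_rpow_norm two_ne_zero ENNReal.ofNat_ne_top]
  refine ENNReal.ofReal_le_ofReal ?_
  simp only [ENNReal.toReal_ofNat, Real.norm_eq_abs, Real.rpow_ofNat, sq_abs]
  exact Real.rpow_le_rpow (integral_nonneg fun _ => sq_nonneg _) (hK n) (by norm_num)

/-- Bounded sequences of `L²` have weakly convergent subsequences. -/
theorem exists_subseq_tendsto_integral_mul [MeasurableSpace.CountablyGenerated X] [SFinite ν]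
    {g : ℕ → X → ℝ} {K : ℝ} (hg : ∀ n, MemLp (g n) 2 ν) (hK : ∀ n, ∫ x, g n x ^ 2 ∂ν ≤ K) :
    ∃ G : X → ℝ, MemLp G 2 ν ∧ ∃ ns : ℕ → ℕ, StrictMono ns ∧ ∀ h : X → ℝ, MemLp h 2 ν →
      Filter.Tendsto (fun n => ∫ x, g (ns n) x * h x ∂ν) Filter.atTop (nhds (∫ x, G x * h x ∂ν)) := by
  have : Fact ((1 : ENNReal) ≤ 2) := ⟨by norm_num⟩
  have : Fact ((2 : ENNReal) ≠ ⊤) := ⟨by norm_num⟩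
  have hinner : ∀ (a b : X → ℝ) (ha : MemLp a 2 ν) (hb : MemLp b 2 ν),
      inner ℝ (ha.toLp a) (hb.toLp b) = ∫ x, a x * b x ∂ν := fun a b ha hb => by
    rw [L2.inner_def]
    refine integral_congr_ae ?_
    filter_upwards [ha.coeFn_toLp, hb.coeFn_toLp] with x h1 h2
    rw [h1, h2]; simp [mul_comm]
  -- Riesz representation moves the sequence into the dual, where closed balls are weak-*
  -- sequentially compact because `L²` is separable.
  set T : Lp ℝ 2 ν ≃ₗᵢ⋆[ℝ] StrongDual ℝ (Lp ℝ 2 ν) := InnerProductSpace.toDual ℝ (Lp ℝ 2 ν)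
  have hb : ∀ n, StrongDual.toWeakDual (T ((hg n).toLp (g n))) ∈
      WeakDual.toStrongDual ⁻¹' Metric.closedBall (0 : StrongDual ℝ (Lp ℝ 2 ν)) (√K) := fun n => by
    simp only [mem_preimage, mem_closedBall_zero_iff]
    show ‖T ((hg n).toLp (g n))‖ ≤ √K
    rw [LinearIsometryEquiv.norm_map]
    refine Real.le_sqrt_of_sq_le ?_
    rw [← real_inner_self_eq_norm_sq, hinner]
    simpa only [sq] using hK n
  obtain ⟨φ, -, ns, hns, hlim⟩ := WeakDual.isSeqCompact_closedBall ℝ (Lp ℝ 2 ν) 0 (√K) hb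
  obtain ⟨G, hG⟩ := T.surjective (WeakDual.toStrongDual φ)
  refine ⟨G, Lp.memLp G, ns, hns, fun h hh => ?_⟩
  have h1 := ((WeakDual.eval_continuous (hh.toLp h)).tendsto φ).comp hlim
  have h2 : φ (hh.toLp h) = ∫ x, G x * h x ∂ν := by
    rw [← hinner G h (Lp.memLp G) hh, Lp.toLp_coeFn]
    show WeakDual.toStrongDual φ (hh.toLp h) = _
    rw [← hG]; rfl
  rw [← h2]
  refine h1.congr fun n => ?_
  rw [← hinner _ _ (hg _) hh]; rfl

end Measure

/-! ### Reduction of the grid measure to single edges. -/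

theorem gridMeasure_eq_sum (ε : ℝ) : gridMeasure ε =
    Measure.sum fun e : GridEdge => (volume.restrict (Ioo 0 ε)).map (Prod.mk e) := by
  rw [gridMeasure, Measure.count, Measure.prod_sum_left]
  simp_rw [Measure.dirac_prod]

theorem ae_gridMeasure_iff {ε : ℝ} {P : GridEdge × ℝ → Prop} :
    (∀ᵐ z ∂gridMeasure ε, P z) ↔ ∀ e : GridEdge, ∀ᵐ t ∂volume.restrict (Ioo 0 ε), P (e, t) := by
  rw [gridMeasure_eq_sum, Measure.ae_sum_iff]
  simp_rw [(measurableEmbedding_prodMk_left _).ae_map_iff]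

theorem measurePreserving_edge (ε : ℝ) (e : GridEdge) :
    MeasurePreserving (Prod.mk e) (volume.restrict (Ioo 0 ε))
      ((volume.restrict (Ioo 0 ε)).map (Prod.mk e)) :=
  ⟨measurable_prodMk_left, rfl⟩

theorem map_edge_le_gridMeasure (ε : ℝ) (e : GridEdge) :
    (volume.restrict (Ioo 0 ε)).map (Prod.mk e) ≤ gridMeasure ε := by
  rw [gridMeasure_eq_sum]
  exact Measure.le_sum (fun e : GridEdge => (volume.restrict (Ioo 0 ε)).map (Prod.mk e)) e

theorem MeasureTheory.MemLp.gridEdge {ε : ℝ} {f : GridEdge × ℝ → ℝ} {r : ENNReal}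
    (hf : MemLp f r (gridMeasure ε)) (e : GridEdge) :
    MemLp (fun t => f (e, t)) r (volume.restrict (Ioo 0 ε)) :=
  (hf.mono_measure (map_edge_le_gridMeasure ε e)).comp_measurePreserving (measurePreserving_edge ε e)

theorem MeasureTheory.MemLp.integrableOn_gridEdge {ε : ℝ} {f : GridEdge × ℝ → ℝ}
    (hf : MemLp f 2 (gridMeasure ε)) (e : GridEdge) :
    IntegrableOn (fun t => f (e, t)) (Ioo 0 ε) :=
  (hf.gridEdge e).integrable one_le_two

theorem MeasureTheory.Integrable.hasSum_gridEdge {ε : ℝ} {f : GridEdge × ℝ → ℝ}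
    (hf : Integrable f (gridMeasure ε)) :
    HasSum (fun e : GridEdge => ∫ t in Ioo 0 ε, f (e, t)) (∫ z, f z ∂gridMeasure ε) := by
  rw [gridMeasure_eq_sum] at hf ⊢
  simpa only [(measurableEmbedding_prodMk_left _).integral_map] using hasSum_integral_measure hf

theorem setIntegral_gridEdge_le {ε : ℝ} {f : GridEdge × ℝ → ℝ}
    (hf : Integrable f (gridMeasure ε)) (h0 : ∀ z, 0 ≤ f z) (e : GridEdge) :
    ∫ t in Ioo 0 ε, f (e, t) ≤ ∫ z, f z ∂gridMeasure ε :=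
  le_hasSum hf.hasSum_gridEdge e fun _ _ => integral_nonneg fun _ => h0 _

/-! ### Continuity on the grid, checked edge by edge. -/

section Topology

theorem continuous_edgePoint (ε : ℝ) (e : GridEdge) : Continuous (edgePoint ε e) := by
  obtain ⟨b, i, j⟩ := e
  cases b
  · exact Continuous.subtype_mk (by fun_prop) _
  · exact Continuous.subtype_mk (by fun_prop) _

theorem exists_edgePoint_eq {ε : ℝ} (hε : 0 < ε) (x : Grid ε) :
    ∃ e : GridEdge, ∃ t ∈ Ico 0 ε, edgePoint ε e t = x := by
  have key : ∀ y : ℝ, y - ε * ⌊y / ε⌋ ∈ Ico 0 ε := fun y => by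
    have h1 := Int.floor_le (y / ε)
    have h2 := Int.lt_floor_add_one (y / ε)
    rw [le_div_iff₀ hε] at h1
    rw [div_lt_iff₀ hε] at h2
    constructor <;> linarith
  obtain ⟨⟨x, y⟩, h⟩ := x
  rcases h with ⟨j, hj⟩ | ⟨i, hi⟩
  · refine ⟨(false, ⌊x / ε⌋, j), _, key x, Subtype.ext (Prod.ext ?_ hj.symm)⟩
    simp [edgePoint]
  · refine ⟨(true, i, ⌊y / ε⌋), _, key y, Subtype.ext (Prod.ext hi.symm ?_)⟩
    simp [edgePoint]

/-- The coordinate along an edge. -/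
def edgeCoord (ε : ℝ) : GridEdge → Grid ε → ℝ
  | (false, i, _), x => x.1.1 - ε * i
  | (true, _, j), x => x.1.2 - ε * j

theorem edgeCoord_edgePoint (ε : ℝ) (e : GridEdge) (t : ℝ) :
    edgeCoord ε e (edgePoint ε e t) = t := by
  obtain ⟨b, i, j⟩ := e
  cases b <;> simp [edgeCoord, edgePoint]

theorem continuous_edgeCoord (ε : ℝ) (e : GridEdge) : Continuous (edgeCoord ε e) := by
  obtain ⟨b, i, j⟩ := e
  cases b
  · exact (continuous_fst.comp continuous_subtype_val).sub continuous_const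
  · exact (continuous_snd.comp continuous_subtype_val).sub continuous_const

theorem finite_setOf_abs_mul_sub_le {ε : ℝ} (hε : 0 < ε) (a c : ℝ) :
    {n : ℤ | |ε * n - a| ≤ c}.Finite := by
  refine (finite_Icc ⌊(a - c) / ε⌋ ⌈(a + c) / ε⌉).subset fun n hn => ?_
  have := abs_le.1 (show |ε * (n : ℝ) - a| ≤ c from hn)
  constructor
  · refine Int.floor_le_iff.2 ?_
    rw [div_lt_iff₀ hε]; nlinarith
  · refine Int.le_ceil_iff.2 ?_
    rw [lt_div_iff₀ hε]; nlinarith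

/-- A function on the grid that is continuous on every closed edge is continuous. -/
theorem continuous_of_continuousOn_edge {ε : ℝ} (hε : 0 < ε) {u : Grid ε → ℝ}
    (h : ∀ e, ContinuousOn (fun t => u (edgePoint ε e t)) (Icc 0 ε)) : Continuous u := by
  set S : GridEdge → Set (Grid ε) := fun e => edgePoint ε e '' Icc 0 ε
  -- The closed edges form a locally finite closed cover; on each one `u` is its edge reading
  -- composed with the continuous coordinate `edgeCoord`.
  have hfin : LocallyFinite S := fun x => by
    refine ⟨Metric.ball x 1, Metric.ball_mem_nhds x one_pos, ?_⟩
    refine ((finite_univ (α := Bool)).prod ((finite_setOf_abs_mul_sub_le hε x.1.1 (1 + ε)).prod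
      (finite_setOf_abs_mul_sub_le hε x.1.2 (1 + ε)))).subset ?_
    rintro ⟨b, i, j⟩ ⟨y, ⟨t, ht, rfl⟩, hy⟩
    refine ⟨mem_univ _, ?_⟩
    change |ε * (i : ℝ) - x.1.1| ≤ 1 + ε ∧ |ε * (j : ℝ) - x.1.2| ≤ 1 + ε
    rw [Metric.mem_ball, Subtype.dist_eq, Prod.dist_eq, max_lt_iff, Real.dist_eq, Real.dist_eq,
      abs_lt, abs_lt] at hy
    obtain ⟨⟨h1, h2⟩, h3, h4⟩ := hy
    cases b <;> simp only [edgePoint] at h1 h2 h3 h4 <;>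
      exact ⟨abs_le.2 ⟨by linarith [ht.1, ht.2], by linarith [ht.1, ht.2]⟩,
        abs_le.2 ⟨by linarith [ht.1, ht.2], by linarith [ht.1, ht.2]⟩⟩
  refine hfin.continuous ?_ (fun e => (isCompact_Icc.image (continuous_edgePoint ε e)).isClosed)
    fun e => ?_
  · refine eq_univ_of_forall fun x => ?_
    obtain ⟨e, t, ht, rfl⟩ := exists_edgePoint_eq hε x
    exact mem_iUnion.2 ⟨e, t, Ico_subset_Icc_self ht, rfl⟩
  · have : EqOn u ((fun t => u (edgePoint ε e t)) ∘ edgeCoord ε e) (S e) := by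
      rintro _ ⟨t, ht, rfl⟩
      simp [edgeCoord_edgePoint]
    refine ContinuousOn.congr ?_ this
    refine (h e).comp (continuous_edgeCoord ε e).continuousOn ?_
    rintro _ ⟨t, ht, rfl⟩
    rwa [edgeCoord_edgePoint]

theorem measurable_onEdges {ε : ℝ} {u : Grid ε → ℝ} (hu : Continuous u) :
    Measurable (onEdges ε u) :=
  measurable_from_prod_countable_right fun e => (hu.comp (continuous_edgePoint ε e)).measurable

end Topology

/-! ### Functions of `H¹` as pairs `(u, u')`. -/

/-- `u` and `g` are square integrable and `u` is on every edge a primitive of `g`. -/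
structure GridPair (ε : ℝ) (u : Grid ε → ℝ) (g : GridEdge × ℝ → ℝ) : Prop where
  memLp_left : MemLp (onEdges ε u) 2 (gridMeasure ε)
  memLp_right : MemLp g 2 (gridMeasure ε)
  eq_primitive : ∀ e : GridEdge, ∀ t ∈ Icc 0 ε,
    u (edgePoint ε e t) = u (edgePoint ε e 0) + ∫ s in (0 : ℝ)..t, g (e, s)

namespace GridPair

variable {ε : ℝ} {u v : Grid ε → ℝ} {g k : GridEdge × ℝ → ℝ}

theorem of_isWeakDeriv (hε : 0 < ε) (hc : Continuous u) (hu : MemLp (onEdges ε u) 2 (gridMeasure ε))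
    (hg : MemLp g 2 (gridMeasure ε)) (h : IsWeakDeriv ε u g) : GridPair ε u g :=
  ⟨hu, hg, fun e => eq_primitive_of_integral_mul_deriv hε (hg.integrableOn_gridEdge e)
    (hc.comp (continuous_edgePoint ε e)).continuousOn (h e)⟩

theorem isWeakDeriv (h : GridPair ε u g) (hε : 0 < ε) : IsWeakDeriv ε u g := fun e _ h1 _ h3 =>
  integral_mul_deriv_of_primitive hε (h.memLp_right.integrableOn_gridEdge e) (h.eq_primitive e) h1 h3

theorem intervalIntegrable (h : GridPair ε u g) (hε : 0 < ε) (e : GridEdge) {s t : ℝ}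
    (hs : s ∈ Icc 0 ε) (ht : t ∈ Icc 0 ε) :
    IntervalIntegrable (fun s => g (e, s)) volume s t := by
  have : IntervalIntegrable (fun s => g (e, s)) volume 0 ε := by
    rw [intervalIntegrable_iff_integrableOn_Ioo_of_le hε.le]
    exact h.memLp_right.integrableOn_gridEdge e
  refine this.mono_set ?_
  rw [uIcc_of_le hε.le]
  exact uIcc_subset_Icc hs ht

theorem continuous (h : GridPair ε u g) (hε : 0 < ε) : Continuous u := by
  refine continuous_of_continuousOn_edge hε fun e => ?_
  have := ((h.intervalIntegrable hε e (left_mem_Icc.2 hε.le)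
    (right_mem_Icc.2 hε.le)).absolutelyContinuousOnInterval_intervalIntegral
    (c := 0) left_mem_uIcc).continuousOn
  rw [uIcc_of_le hε.le] at this
  exact (continuousOn_const.add this).congr (h.eq_primitive e)

theorem isGridH1 (h : GridPair ε u g) (hε : 0 < ε) : IsGridH1 ε u :=
  ⟨h.continuous hε, h.memLp_left, g, h.memLp_right, h.isWeakDeriv hε⟩

/-- `gridDeriv` is obtained by choice; testing on each edge identifies the chosen function with `g`
almost everywhere, so the energy can be computed from any weak derivative. -/
theorem gridDeriv_ae_eq (h : GridPair ε u g) (hε : 0 < ε) :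
    gridDeriv ε u =ᵐ[gridMeasure ε] g := by
  have hex : ∃ g, MemLp g 2 (gridMeasure ε) ∧ IsWeakDeriv ε u g :=
    ⟨g, h.memLp_right, h.isWeakDeriv hε⟩
  have hd : gridDeriv ε u = hex.choose := dif_pos hex
  obtain ⟨h1, h2⟩ := hex.choose_spec
  rw [← hd] at h1 h2
  refine ae_gridMeasure_iff.2 fun e => ?_
  have i1 := h1.integrableOn_gridEdge e
  have i2 := h.memLp_right.integrableOn_gridEdge e
  rw [ae_restrict_iff' measurableSet_Ioo]
  have := isOpen_Ioo.ae_eq_zero_of_integral_contDiff_smul_eq_zero (μ := volume)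
    (i1.sub i2).locallyIntegrableOn fun φ hφ hc hs => ?_
  · filter_upwards [this] with t ht h' using sub_eq_zero.1 (ht h')
  · have hz : ∀ t, t ∉ Ioo 0 ε → φ t • (gridDeriv ε u (e, t) - g (e, t)) = 0 := fun t ht => by
      have : φ t = 0 := by
        by_contra h'
        exact ht (hs (subset_tsupport _ h'))
      simp [this]
    have hb : ∀ f : ℝ → ℝ, IntegrableOn f (Ioo 0 ε) →
        IntegrableOn (fun t => f t * φ t) (Ioo 0 ε) := fun f hf => by
      obtain ⟨C, hC⟩ := hc.exists_bound_of_continuous hφ.continuous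
      exact Integrable.mul_bdd hf hφ.continuous.aestronglyMeasurable
        (Filter.Eventually.of_forall hC)
    show ∫ t, φ t • (gridDeriv ε u (e, t) - g (e, t)) = 0
    rw [← setIntegral_eq_integral_of_forall_compl_eq_zero hz]
    have e1 := h2 e φ hφ hc hs
    rw [h.isWeakDeriv hε e φ hφ hc hs, neg_inj] at e1
    simp only [smul_eq_mul, mul_comm (φ _), sub_mul]
    rw [integral_sub (hb _ i1) (hb _ i2), e1, sub_self]

theorem smul (h : GridPair ε u g) (c : ℝ) : GridPair ε (fun x => c * u x) (fun z => c * g z) :=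
  ⟨h.memLp_left.const_mul c, h.memLp_right.const_mul c, fun e t ht => by
    rw [h.eq_primitive e t ht, mul_add, intervalIntegral.integral_const_mul]⟩

theorem sub (h : GridPair ε u g) (hv : GridPair ε v k) (hε : 0 < ε) :
    GridPair ε (fun x => u x - v x) (fun z => g z - k z) :=
  ⟨h.memLp_left.sub hv.memLp_left, h.memLp_right.sub hv.memLp_right, fun e t ht => by
    rw [h.eq_primitive e t ht, hv.eq_primitive e t ht,
      intervalIntegral.integral_sub (h.intervalIntegrable hε e (left_mem_Icc.2 hε.le) ht)
        (hv.intervalIntegrable hε e (left_mem_Icc.2 hε.le) ht)]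
    ring⟩

end GridPair

theorem IsGridH1.exists_gridPair {ε : ℝ} {u : Grid ε → ℝ} (hε : 0 < ε) (h : IsGridH1 ε u) :
    ∃ g, GridPair ε u g := by
  obtain ⟨g, h1, h2⟩ := h.exists_weakDeriv
  exact ⟨g, .of_isWeakDeriv hε h.continuous h.memLp h1 h2⟩

/-! ### Mass, kinetic term, energy and the sup bound. -/

/-- The mass `‖u‖²` of a function on the grid. -/
noncomputable def gridMass (ε : ℝ) (u : Grid ε → ℝ) : ℝ := ∫ z, onEdges ε u z ^ 2 ∂gridMeasure ε

/-- The squared `L²` norm of a function in edge coordinates. -/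
noncomputable def gridKinetic (ε : ℝ) (g : GridEdge × ℝ → ℝ) : ℝ := ∫ z, g z ^ 2 ∂gridMeasure ε

/-- The bound of `u²` on the grid for `u` of mass `m` and kinetic term `k`. -/
noncomputable def gridBound (ε m k : ℝ) : ℝ := ε⁻¹ * m + 2 * √(m * k)

/-- The energy of a pair `(u, u')`, with the point interactions at the vertices in `εW`. -/
noncomputable def pairEnergy (ε p q α β : ℝ) (W : Set (ℤ × ℤ)) (u : Grid ε → ℝ) (g : GridEdge × ℝ → ℝ) : ℝ :=
  1 / 2 * gridKinetic ε g - α / p * ∫ z, |onEdges ε u z| ^ p ∂gridMeasure ε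
    - β / q * ∫ w in W, |u (gridVertex ε w)| ^ q ∂Measure.count

theorem gridMass_nonneg (ε : ℝ) (u : Grid ε → ℝ) : 0 ≤ gridMass ε u :=
  integral_nonneg fun _ => sq_nonneg _

theorem gridKinetic_nonneg (ε : ℝ) (g : GridEdge × ℝ → ℝ) : 0 ≤ gridKinetic ε g :=
  integral_nonneg fun _ => sq_nonneg _

theorem gridBound_nonneg {ε m : ℝ} (hε : 0 < ε) (hm : 0 ≤ m) (k : ℝ) : 0 ≤ gridBound ε m k := by
  unfold gridBound; positivity

theorem gridBound_mono {ε m m' k k' : ℝ} (hε : 0 < ε) (hm0 : 0 ≤ m) (hm : m ≤ m') (hk0 : 0 ≤ k)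
    (hk : k ≤ k') : gridBound ε m k ≤ gridBound ε m' k' := by
  unfold gridBound; gcongr; linarith

theorem gridVertex_eq_edgePoint (ε : ℝ) (w : ℤ × ℤ) :
    gridVertex ε w = edgePoint ε (false, w) 0 := by
  obtain ⟨i, j⟩ := w
  exact Subtype.ext (by simp [gridVertex, edgePoint])

theorem gridVertex_injective {ε : ℝ} (hε : 0 < ε) : Function.Injective (gridVertex ε) := by
  intro v w h
  have := congrArg Subtype.val h
  simp only [gridVertex, Prod.mk.injEq, mul_eq_mul_left_iff, Int.cast_inj, hε.ne', or_false] at this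
  exact Prod.ext this.1 this.2

namespace GridPair

variable {ε : ℝ} {u v : Grid ε → ℝ} {g k : GridEdge × ℝ → ℝ}

theorem integrable_mul (h : GridPair ε u g) :
    Integrable (fun z => 2 * (|onEdges ε u z| * |g z|)) (gridMeasure ε) :=
  (h.memLp_left.abs.integrable_mul h.memLp_right.abs).const_mul 2

/-- The right-hand side is kept local to the edge: it is summable over edges, which later gives the
square summability of the vertex values. -/
theorem sq_le_edge (h : GridPair ε u g) (hε : 0 < ε) (e : GridEdge) {t : ℝ} (ht : t ∈ Icc 0 ε) :
    u (edgePoint ε e t) ^ 2 ≤ ε⁻¹ * (∫ s in Ioo 0 ε, onEdges ε u (e, s) ^ 2) +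
      ∫ s in Ioo 0 ε, 2 * (|onEdges ε u (e, s)| * |g (e, s)|) := by
  have := sq_le_of_primitive hε (h.memLp_right.integrableOn_gridEdge e) (h.eq_primitive e) ht
  rwa [sub_zero] at this

/-- Only the mass of one edge enters, so uniformly small edge masses make the sup norm small. This
is what excludes vanishing. -/
theorem sq_le_of_edge_le (h : GridPair ε u g) (hε : 0 < ε) {η : ℝ}
    (hη : ∀ e, ∫ s in Ioo 0 ε, onEdges ε u (e, s) ^ 2 ≤ η) (x : Grid ε) :
    u x ^ 2 ≤ gridBound ε η (gridKinetic ε g) := by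
  obtain ⟨e, t, ht, rfl⟩ := exists_edgePoint_eq hε x
  refine (h.sq_le_edge hε e (Ico_subset_Icc_self ht)).trans ?_
  have h1 := integral_abs_mul_abs_le_sqrt (h.memLp_left.gridEdge e) (h.memLp_right.gridEdge e)
  have h2 : ∫ s in Ioo 0 ε, g (e, s) ^ 2 ≤ gridKinetic ε g :=
    setIntegral_gridEdge_le h.memLp_right.integrable_sq (fun _ => sq_nonneg _) e
  have h3 : 0 ≤ ∫ s in Ioo 0 ε, onEdges ε u (e, s) ^ 2 := integral_nonneg fun _ => sq_nonneg _
  have h4 : 0 ≤ ∫ s in Ioo 0 ε, g (e, s) ^ 2 := integral_nonneg fun _ => sq_nonneg _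
  rw [integral_const_mul, gridBound]
  have h5 : √((∫ s in Ioo 0 ε, onEdges ε u (e, s) ^ 2) * ∫ s in Ioo 0 ε, g (e, s) ^ 2) ≤
      √(η * gridKinetic ε g) :=
    Real.sqrt_le_sqrt (mul_le_mul (hη e) h2 h4 (h3.trans (hη e)))
  have := hη e
  gcongr
  exact h1.trans h5

theorem sq_le (h : GridPair ε u g) (hε : 0 < ε) (x : Grid ε) :
    u x ^ 2 ≤ gridBound ε (gridMass ε u) (gridKinetic ε g) :=
  h.sq_le_of_edge_le hε (fun e =>
    setIntegral_gridEdge_le h.memLp_left.integrable_sq (fun _ => sq_nonneg _) e) x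

theorem hasSum_edge (h : GridPair ε u g) :
    HasSum (fun e : GridEdge => ε⁻¹ * (∫ s in Ioo 0 ε, onEdges ε u (e, s) ^ 2) +
      ∫ s in Ioo 0 ε, 2 * (|onEdges ε u (e, s)| * |g (e, s)|))
    (ε⁻¹ * gridMass ε u + ∫ z, 2 * (|onEdges ε u z| * |g z|) ∂gridMeasure ε) :=
  (h.memLp_left.integrable_sq.hasSum_gridEdge.mul_left ε⁻¹).add h.integrable_mul.hasSum_gridEdge

/-- Each vertex is charged to the horizontal edge that starts there. This assignment is injective,
so the edge bounds add up to at most the global one. -/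
theorem memLp_vertex (h : GridPair ε u g) (hε : 0 < ε) :
    MemLp (fun w => u (gridVertex ε w)) 2 Measure.count ∧
      ∫ w, u (gridVertex ε w) ^ 2 ∂Measure.count ≤
        gridBound ε (gridMass ε u) (gridKinetic ε g) := by
  set c : GridEdge → ℝ := fun e => ε⁻¹ * (∫ s in Ioo 0 ε, onEdges ε u (e, s) ^ 2) +
      ∫ s in Ioo 0 ε, 2 * (|onEdges ε u (e, s)| * |g (e, s)|) with hc
  have hle : ∀ w : ℤ × ℤ, u (gridVertex ε w) ^ 2 ≤ c (false, w) := fun w => by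
    rw [gridVertex_eq_edgePoint]
    exact h.sq_le_edge hε _ (left_mem_Icc.2 hε.le)
  have hc0 : ∀ e, 0 ≤ c e := fun e => by
    have h1 : 0 ≤ ∫ s in Ioo 0 ε, onEdges ε u (e, s) ^ 2 := integral_nonneg fun _ => sq_nonneg _
    have h2 : 0 ≤ ∫ s in Ioo 0 ε, 2 * (|onEdges ε u (e, s)| * |g (e, s)|) :=
      integral_nonneg fun _ => by positivity
    simp only [hc]; positivity
  have hinj : Function.Injective fun w : ℤ × ℤ => ((false, w) : GridEdge) :=
    fun a b hab => by simpa using hab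
  have hs : Summable fun w : ℤ × ℤ => c (false, w) := h.hasSum_edge.summable.comp_injective hinj
  have hs2 : Summable fun w => u (gridVertex ε w) ^ 2 :=
    Summable.of_nonneg_of_le (fun _ => sq_nonneg _) hle hs
  have hint : Integrable (fun w => u (gridVertex ε w) ^ 2) Measure.count :=
    integrable_count_iff.2 hs2.abs
  refine ⟨(memLp_two_iff_integrable_sq (Measurable.of_discrete).aestronglyMeasurable).2 hint, ?_⟩
  rw [integral_countable hint]
  simp only [count_real_singleton, one_smul]
  calc ∑' w, u (gridVertex ε w) ^ 2 ≤ ∑' w : ℤ × ℤ, c (false, w) := hs2.tsum_le_tsum hle hs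
    _ ≤ ∑' e, c e := tsum_comp_le_tsum_of_inj h.hasSum_edge.summable hc0 hinj
    _ = ε⁻¹ * gridMass ε u + ∫ z, 2 * (|onEdges ε u z| * |g z|) ∂gridMeasure ε :=
      h.hasSum_edge.tsum_eq
    _ ≤ _ := by
      rw [integral_const_mul, gridBound]
      gcongr
      exact integral_abs_mul_abs_le_sqrt h.memLp_left h.memLp_right

theorem memLp_vertex_restrict (h : GridPair ε u g) (hε : 0 < ε) (W : Set (ℤ × ℤ)) :
    MemLp (fun w => u (gridVertex ε w)) 2 (Measure.count.restrict W) ∧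
      ∫ w in W, u (gridVertex ε w) ^ 2 ∂Measure.count ≤
        gridBound ε (gridMass ε u) (gridKinetic ε g) :=
  ⟨(h.memLp_vertex hε).1.restrict W,
    (setIntegral_le_integral (h.memLp_vertex hε).1.integrable_sq
      (Filter.Eventually.of_forall fun _ => sq_nonneg _)).trans (h.memLp_vertex hε).2⟩

/-- Writing the vertex sum as an integral against counting measure lets the same `L²` lemmas handle
the edges and the vertices. -/
theorem gridEnergy_eq (h : GridPair ε u g) (hε : 0 < ε) {p q α β : ℝ} (hq : 2 ≤ q)
    {W : Set (ℤ × ℤ)} {V : Set (Grid ε)} (hV : V = gridVertex ε '' W) :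
    gridEnergy ε p q α β V u = pairEnergy ε p q α β W u g := by
  have h1 : ∫ z, gridDeriv ε u z ^ 2 ∂gridMeasure ε = gridKinetic ε g :=
    integral_congr_ae (by filter_upwards [h.gridDeriv_ae_eq hε] with z hz; rw [hz])
  have h2 : ∑' v : V, |u v| ^ q = ∫ w in W, |u (gridVertex ε w)| ^ q ∂Measure.count := by
    rw [setIntegral_countable _ W.to_countable]
    · simp only [count_real_singleton, one_smul]
      subst hV
      exact tsum_image (fun v => |u v| ^ q) (gridVertex_injective hε).injOn
    · exact ((h.memLp_vertex_restrict hε W).1.integrable_abs_rpow_of_bound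
        (Filter.Eventually.of_forall fun w => Real.abs_le_sqrt (h.sq_le hε _)) hq).1
  rw [gridEnergy, pairEnergy, h1, h2]

theorem integral_abs_rpow_le (h : GridPair ε u g) {c p : ℝ} (hc : ∀ x, |u x| ≤ c) (hp : 2 ≤ p) :
    ∫ z, |onEdges ε u z| ^ p ∂gridMeasure ε ≤ c ^ (p - 2) * gridMass ε u :=
  (h.memLp_left.integrable_abs_rpow_of_bound (Filter.Eventually.of_forall fun _ => hc _) hp).2

theorem integral_vertex_abs_rpow_le (h : GridPair ε u g) (hε : 0 < ε) {c q : ℝ} (hc0 : 0 ≤ c)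
    (hc : ∀ x, |u x| ≤ c) (hq : 2 ≤ q) (W : Set (ℤ × ℤ)) :
    ∫ w in W, |u (gridVertex ε w)| ^ q ∂Measure.count ≤
      c ^ (q - 2) * gridBound ε (gridMass ε u) (gridKinetic ε g) :=
  ((h.memLp_vertex_restrict hε W).1.integrable_abs_rpow_of_bound
    (Filter.Eventually.of_forall fun _ => hc _) hq).2.trans
    (mul_le_mul_of_nonneg_left (h.memLp_vertex_restrict hε W).2 (Real.rpow_nonneg hc0 _))

/-- The sup bound `c` is left free: the global bound gives coercivity, the edgewise bound gives
non-vanishing, and `c = 0` treats zero mass. -/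
theorem le_pairEnergy (h : GridPair ε u g) (hε : 0 < ε) {p q α β c : ℝ} (hp : 2 ≤ p) (hq : 2 ≤ q)
    (hα : 0 ≤ α) (hβ : 0 ≤ β) (W : Set (ℤ × ℤ)) (hc0 : 0 ≤ c) (hc : ∀ x, |u x| ≤ c) :
    1 / 2 * gridKinetic ε g - α / p * (c ^ (p - 2) * gridMass ε u) -
      β / q * (c ^ (q - 2) * gridBound ε (gridMass ε u) (gridKinetic ε g)) ≤
    pairEnergy ε p q α β W u g := by
  have h1 := mul_le_mul_of_nonneg_left (h.integral_abs_rpow_le hc hp)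
    (show 0 ≤ α / p by positivity)
  have h2 := mul_le_mul_of_nonneg_left (h.integral_vertex_abs_rpow_le hε hc0 hc hq W)
    (show 0 ≤ β / q by positivity)
  unfold pairEnergy
  linarith

end GridPair

/-! ### Behaviour under multiplication by a constant. -/

section Scaling

variable {ε : ℝ} {u : Grid ε → ℝ} {g : GridEdge × ℝ → ℝ}

theorem gridMass_const_mul (c : ℝ) : gridMass ε (fun x => c * u x) = c ^ 2 * gridMass ε u := by
  unfold gridMass
  rw [← integral_const_mul]
  congr 1; ext z; simp only [onEdges]; ring

theorem gridKinetic_const_mul (c : ℝ) : gridKinetic ε (fun z => c * g z) = c ^ 2 * gridKinetic ε g := by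
  unfold gridKinetic
  rw [← integral_const_mul]
  congr 1; ext z; ring

theorem pairEnergy_const_mul {p q α β c : ℝ} (hc : 0 ≤ c) (W : Set (ℤ × ℤ)) :
    pairEnergy ε p q α β W (fun x => c * u x) (fun z => c * g z) =
      1 / 2 * (c ^ 2 * gridKinetic ε g)
        - α / p * (c ^ p * ∫ z, |onEdges ε u z| ^ p ∂gridMeasure ε)
        - β / q * (c ^ q * ∫ w in W, |u (gridVertex ε w)| ^ q ∂Measure.count) := by
  have h1 : ∫ z, |onEdges ε (fun x => c * u x) z| ^ p ∂gridMeasure ε =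
      c ^ p * ∫ z, |onEdges ε u z| ^ p ∂gridMeasure ε := by
    rw [← integral_const_mul]
    simp only [onEdges, abs_mul, abs_of_nonneg hc, Real.mul_rpow hc (abs_nonneg _)]
  have h2 : ∫ w in W, |c * u (gridVertex ε w)| ^ q ∂Measure.count =
      c ^ q * ∫ w in W, |u (gridVertex ε w)| ^ q ∂Measure.count := by
    rw [← integral_const_mul]
    simp only [abs_mul, abs_of_nonneg hc, Real.mul_rpow hc (abs_nonneg _)]
  rw [pairEnergy, gridKinetic_const_mul, h1, h2]

end Scaling

/-! ### Translations of the grid and periods of the vertex set. -/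

section Translation

theorem measurePreserving_count_equiv {X : Type*} [MeasurableSpace X] (σ : X ≃ᵐ X) :
    MeasurePreserving σ (Measure.count : Measure X) Measure.count := by
  refine ⟨σ.measurable, Measure.ext fun s hs => ?_⟩
  rw [Measure.map_apply σ.measurable hs, Measure.count_apply (σ.measurable hs),
    Measure.count_apply hs, encard_preimage_of_bijective σ.bijective]

/-- Translation of the grid by `ε a`. -/
def gridShift (ε : ℝ) (a : ℤ × ℤ) (x : Grid ε) : Grid ε :=
  ⟨(x.1.1 + ε * a.1, x.1.2 + ε * a.2), by
    rcases x.2 with ⟨j, hj⟩ | ⟨i, hi⟩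
    · exact Or.inl ⟨j + a.2, by push_cast; rw [hj]; ring⟩
    · exact Or.inr ⟨i + a.1, by push_cast; rw [hi]; ring⟩⟩

/-- Translation of the edges. -/
def edgeShift (a : ℤ × ℤ) : GridEdge ≃ᵐ GridEdge :=
  MeasurableEquiv.prodCongr (MeasurableEquiv.refl Bool) (MeasurableEquiv.addRight a)

/-- Translation in edge coordinates. -/
def edgeCoordShift (a : ℤ × ℤ) : GridEdge × ℝ ≃ᵐ GridEdge × ℝ :=
  MeasurableEquiv.prodCongr (edgeShift a) (MeasurableEquiv.refl ℝ)

theorem measurePreserving_edgeCoordShift (ε : ℝ) (a : ℤ × ℤ) :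
    MeasurePreserving (edgeCoordShift a) (gridMeasure ε) (gridMeasure ε) :=
  (measurePreserving_count_equiv (edgeShift a)).prod (MeasurePreserving.id _)

theorem gridShift_edgePoint (ε : ℝ) (a : ℤ × ℤ) (e : GridEdge) (t : ℝ) :
    gridShift ε a (edgePoint ε e t) = edgePoint ε (edgeShift a e) t := by
  obtain ⟨b, i, j⟩ := e
  obtain ⟨c, d⟩ := a
  refine Subtype.ext ?_
  cases b
  · show ((ε * (i : ℝ) + t + ε * (c : ℝ), ε * (j : ℝ) + ε * (d : ℝ)) : ℝ × ℝ) =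
      (ε * ((i + c : ℤ) : ℝ) + t, ε * ((j + d : ℤ) : ℝ))
    push_cast; ext <;> simp <;> ring
  · show ((ε * (i : ℝ) + ε * (c : ℝ), ε * (j : ℝ) + t + ε * (d : ℝ)) : ℝ × ℝ) =
      (ε * ((i + c : ℤ) : ℝ), ε * ((j + d : ℤ) : ℝ) + t)
    push_cast; ext <;> simp <;> ring

theorem gridShift_gridVertex (ε : ℝ) (a w : ℤ × ℤ) :
    gridShift ε a (gridVertex ε w) = gridVertex ε (w + a) :=
  Subtype.ext (by simp [gridShift, gridVertex, mul_add])

variable {ε : ℝ} {u : Grid ε → ℝ} {g : GridEdge × ℝ → ℝ}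

theorem onEdges_gridShift (a : ℤ × ℤ) :
    onEdges ε (u ∘ gridShift ε a) = onEdges ε u ∘ edgeCoordShift a := by
  ext ⟨e, t⟩
  simp only [onEdges, Function.comp_apply, gridShift_edgePoint]
  rfl

theorem GridPair.shift (h : GridPair ε u g) (a : ℤ × ℤ) :
    GridPair ε (u ∘ gridShift ε a) (g ∘ edgeCoordShift a) := by
  refine ⟨?_, h.memLp_right.comp_measurePreserving (measurePreserving_edgeCoordShift ε a),
    fun e t ht => ?_⟩
  · rw [onEdges_gridShift]
    exact h.memLp_left.comp_measurePreserving (measurePreserving_edgeCoordShift ε a)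
  · simp only [Function.comp_apply, gridShift_edgePoint]
    exact h.eq_primitive (edgeShift a e) t ht

theorem gridMass_gridShift (a : ℤ × ℤ) : gridMass ε (u ∘ gridShift ε a) = gridMass ε u := by
  unfold gridMass
  rw [onEdges_gridShift]
  exact (measurePreserving_edgeCoordShift ε a).integral_comp' (fun z => onEdges ε u z ^ 2)

theorem gridKinetic_edgeCoordShift (a : ℤ × ℤ) :
    gridKinetic ε (g ∘ edgeCoordShift a) = gridKinetic ε g :=
  (measurePreserving_edgeCoordShift ε a).integral_comp' (fun z => g z ^ 2)

/-- The edge terms are invariant under all lattice translations; only the vertex term requires `a`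
to be a period of `W`. -/
theorem pairEnergy_gridShift {p q α β : ℝ} {W : Set (ℤ × ℤ)} {a : ℤ × ℤ}
    (ha : ∀ w, w + a ∈ W ↔ w ∈ W) :
    pairEnergy ε p q α β W (u ∘ gridShift ε a) (g ∘ edgeCoordShift a) =
      pairEnergy ε p q α β W u g := by
  have h1 : ∫ z, |onEdges ε (u ∘ gridShift ε a) z| ^ p ∂gridMeasure ε =
      ∫ z, |onEdges ε u z| ^ p ∂gridMeasure ε := by
    rw [onEdges_gridShift]
    exact (measurePreserving_edgeCoordShift ε a).integral_comp' (fun z => |onEdges ε u z| ^ p)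
  have h2 : ∫ w in W, |(u ∘ gridShift ε a) (gridVertex ε w)| ^ q ∂Measure.count =
      ∫ w in W, |u (gridVertex ε w)| ^ q ∂Measure.count := by
    have := (measurePreserving_count_equiv (MeasurableEquiv.addRight a)).setIntegral_preimage_emb
      (MeasurableEquiv.addRight a).measurableEmbedding (fun w => |u (gridVertex ε w)| ^ q) W
    have hW : (MeasurableEquiv.addRight a) ⁻¹' W = W := Set.ext fun w => ha w
    rw [hW] at this
    rw [← this]
    simp only [Function.comp_apply, gridShift_gridVertex]
    rfl
  rw [pairEnergy, pairEnergy, h1, h2, gridKinetic_edgeCoordShift]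

end Translation

/-- By Cramer's rule the determinant times any integer vector is an integer combination of the two
periods, so its absolute value serves as `D`. A square period permits reduction to a box by division
in each coordinate. -/
theorem IsZ2PeriodicLattice.exists_square_period {W : Set (ℤ × ℤ)} (hW : IsZ2PeriodicLattice W) :
    ∃ D : ℤ, 0 < D ∧ ∀ z w : ℤ × ℤ, w + D • z ∈ W ↔ w ∈ W := by
  obtain ⟨⟨a, b⟩, ⟨c, d⟩, hli, hper⟩ := hW
  have hmem : ∀ (k₁ k₂ : ℤ) (w : ℤ × ℤ), w ∈ W → w + k₁ • (a, b) + k₂ • (c, d) ∈ W :=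
    fun k₁ k₂ w hw => by rw [hper k₁ k₂]; exact mem_image_of_mem _ hw
  have hΔ : a * d - b * c ≠ 0 := by
    intro h
    rw [LinearIndependent.pair_iff] at hli
    -- With zero determinant, `d v₁ - b v₂ = 0` and `c v₁ - a v₂ = 0`, so `a = b = 0` and `v₁ = 0`.
    have h1 := hli d (-b) (by ext <;> simp <;> linarith)
    have h2 := hli c (-a) (by ext <;> simp <;> linarith)
    have h3 := hli 1 0 (by ext <;> simp <;> linarith [h1.2, h2.2])
    exact one_ne_zero h3.1
  have key : ∀ z w : ℤ × ℤ, w ∈ W → w + (a * d - b * c) • z ∈ W := by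
    rintro ⟨x, y⟩ w hw
    have := hmem (x * d - y * c) (y * a - x * b) w hw
    convert this using 1
    ext <;> simp <;> ring
  have key' : ∀ z w : ℤ × ℤ, w ∈ W → w + |a * d - b * c| • z ∈ W := by
    intro z w hw
    rcases abs_choice (a * d - b * c) with h | h
    · rw [h]; exact key z w hw
    · rw [h, neg_smul, ← smul_neg]; exact key (-z) w hw
  refine ⟨|a * d - b * c|, abs_pos.2 hΔ, fun z w => ⟨fun h => ?_, key' z w⟩⟩
  have := key' (-z) _ h
  simpa using this

/-! ### Tent functions and negativity of the energy. -/

section Tent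

/-- A bounded function supported on finitely many edges is square integrable. -/
theorem memLp_two_of_finset_edges {ε C : ℝ} (hε : 0 < ε) {f : GridEdge × ℝ → ℝ}
    (hf : Measurable f) (S : Finset GridEdge) (hC : ∀ z, |f z| ≤ C)
    (hS : ∀ e ∉ S, ∀ t ∈ Ioo 0 ε, f (e, t) = 0) :
    MemLp f 2 (gridMeasure ε) ∧ ∫ z, f z ^ 2 ∂gridMeasure ε ≤ C ^ 2 * (S.card * ε) := by
  have hmS : MeasurableSet ((S : Set GridEdge) ×ˢ (univ : Set ℝ)) :=
    S.measurableSet.prod MeasurableSet.univ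
  have hvol : gridMeasure ε ((S : Set GridEdge) ×ˢ (univ : Set ℝ)) =
      ENNReal.ofReal (S.card * ε) := by
    rw [gridMeasure, Measure.prod_prod, Measure.count_apply_finset, Measure.restrict_apply_univ,
      Real.volume_Ioo, sub_zero, ENNReal.ofReal_mul (by positivity), ENNReal.ofReal_natCast]
  have hle : ∀ᵐ z ∂gridMeasure ε,
      f z ^ 2 ≤ ((S : Set GridEdge) ×ˢ (univ : Set ℝ)).indicator (fun _ => C ^ 2) z := by
    refine ae_gridMeasure_iff.2 fun e => ?_
    filter_upwards [ae_restrict_mem measurableSet_Ioo] with t ht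
    by_cases he : e ∈ S
    · rw [indicator_of_mem (by simpa using he)]
      exact sq_le_sq.2 ((hC _).trans (le_abs_self C))
    · rw [hS e he t ht, indicator_of_notMem (by simpa using he)]; simp
  have hind : Integrable (((S : Set GridEdge) ×ˢ (univ : Set ℝ)).indicator fun _ => C ^ 2)
      (gridMeasure ε) :=
    (integrable_indicator_iff hmS).2 (integrableOn_const (by rw [hvol]; exact ENNReal.ofReal_ne_top))
  have hint : Integrable (fun z => f z ^ 2) (gridMeasure ε) :=
    hind.mono' (hf.pow_const 2).aestronglyMeasurable (by
      filter_upwards [hle] with z hz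
      rwa [Real.norm_of_nonneg (sq_nonneg _)])
  refine ⟨(memLp_two_iff_integrable_sq hf.aestronglyMeasurable).2 hint, ?_⟩
  refine (integral_mono_ae hint hind hle).trans_eq ?_
  rw [integral_indicator_const _ hmS, Measure.real, hvol, ENNReal.toReal_ofReal (by positivity),
    smul_eq_mul, mul_comm]

/-- The tent of height one supported in an `ℓ¹` ball of radius `ε N`. -/
noncomputable def gridTent (ε : ℝ) (N : ℕ) (x : Grid ε) : ℝ :=
  max 0 (1 - (|x.1.1| + |x.1.2|) / (ε * N))

theorem gridTent_nonneg (ε : ℝ) (N : ℕ) (x : Grid ε) : 0 ≤ gridTent ε N x := le_max_left _ _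

theorem abs_gridTent_le {ε : ℝ} (hε : 0 < ε) (N : ℕ) (x : Grid ε) : |gridTent ε N x| ≤ 1 := by
  rw [abs_of_nonneg (gridTent_nonneg ε N x)]
  exact max_le zero_le_one (sub_le_self _ (by positivity))

theorem continuous_gridTent (ε : ℝ) (N : ℕ) : Continuous (gridTent ε N) := by
  unfold gridTent
  have h1 : Continuous fun x : Grid ε => x.1.1 := continuous_fst.comp continuous_subtype_val
  have h2 : Continuous fun x : Grid ε => x.1.2 := continuous_snd.comp continuous_subtype_val
  exact continuous_const.max (continuous_const.sub ((h1.abs.add h2.abs).div_const _))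

theorem lipschitzWith_gridTent_edge {ε : ℝ} (hε : 0 < ε) {N : ℕ} (hN : 0 < N) (e : GridEdge) :
    LipschitzWith (Real.toNNReal (ε * N)⁻¹) fun t => gridTent ε N (edgePoint ε e t) := by
  refine LipschitzWith.of_dist_le_mul fun s t => ?_
  have hL : 0 < ε * N := by positivity
  rw [Real.coe_toNNReal _ (inv_nonneg.2 hL.le), Real.dist_eq, Real.dist_eq]
  have key : ∀ c d : ℝ, |max 0 (1 - (|c + s| + |d|) / (ε * N)) -
      max 0 (1 - (|c + t| + |d|) / (ε * N))| ≤ (ε * N)⁻¹ * |s - t| := fun c d => by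
    refine (abs_max_sub_max_le_max _ _ _ _).trans ?_
    rw [sub_self, abs_zero]
    refine max_le (by positivity) ?_
    rw [sub_sub_sub_cancel_left, ← sub_div, add_sub_add_right_eq_sub, abs_div, abs_of_pos hL,
      div_eq_inv_mul, abs_sub_comm s t]
    refine mul_le_mul_of_nonneg_left ?_ (inv_nonneg.2 hL.le)
    refine (abs_abs_sub_abs_le (c + t) (c + s)).trans_eq ?_
    congr 1; ring
  obtain ⟨b, i, j⟩ := e
  cases b
  · exact key _ _
  · simp only [gridTent, edgePoint, add_comm |ε * (i : ℝ)|]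
    exact key _ _

theorem gridTent_edge_eq_zero {ε : ℝ} (hε : 0 < ε) {N : ℕ} (hN : 0 < N) {e : GridEdge}
    (he : e ∉ (Finset.univ : Finset Bool) ×ˢ (Finset.Icc (-(2 * N : ℤ)) (2 * N)) ×ˢ
      (Finset.Icc (-(2 * N : ℤ)) (2 * N))) {t : ℝ} (ht : t ∈ Icc 0 ε) :
    gridTent ε N (edgePoint ε e t) = 0 := by
  have hL : 0 < ε * N := by positivity
  have hN1 : (1 : ℝ) ≤ N := by exact_mod_cast hN
  have key : ∀ (n : ℤ) (s : ℝ), s ∈ Icc 0 ε → n ∉ Finset.Icc (-(2 * N : ℤ)) (2 * N) →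
      ε * N ≤ |ε * n + s| := fun n s hs hn => by
    simp only [Finset.mem_Icc, not_and_or, not_le] at hn
    rcases hn with h | h
    · have h' : (n : ℝ) ≤ -(2 * N) - 1 := by
        have : n ≤ -(2 * N) - 1 := by omega
        exact_mod_cast this
      rw [abs_of_nonpos (by nlinarith [hs.2])]
      nlinarith [hs.2]
    · have h' : (2 * N + 1 : ℝ) ≤ n := by exact_mod_cast h
      rw [abs_of_nonneg (by nlinarith [hs.1])]
      nlinarith [hs.1]
  have key2 : ∀ a b : ℝ, ε * N ≤ |a| ∨ ε * N ≤ |b| → max 0 (1 - (|a| + |b|) / (ε * N)) = 0 := by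
    intro a b h
    refine max_eq_left ?_
    rw [sub_nonpos, le_div_iff₀ hL]
    rcases h with h | h <;> linarith [abs_nonneg a, abs_nonneg b]
  obtain ⟨b, i, j⟩ := e
  simp only [Finset.mem_product, Finset.mem_univ, true_and, not_and_or] at he
  have h0 : (0 : ℝ) ∈ Icc 0 ε := left_mem_Icc.2 hε.le
  cases b
  · exact key2 _ _ (he.imp (key i t ht) fun h => by
      have := key j 0 h0 h; rw [add_zero] at this; exact this)
  · exact key2 _ _ (he.imp (fun h => by
      have := key i 0 h0 h; rw [add_zero] at this; exact this) (key j t ht))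

/-- The tent lives on at most `2 (4N + 1)² ≤ 50 N²` edges and has slope at most `1 / (εN)`, so its
kinetic term stays bounded while its support grows. -/
theorem exists_gridPair_gridTent {ε : ℝ} (hε : 0 < ε) {N : ℕ} (hN : 0 < N) :
    ∃ g, GridPair ε (gridTent ε N) g ∧ gridMass ε (gridTent ε N) ≤ 50 * N ^ 2 * ε ∧
      gridKinetic ε g ≤ 50 / ε := by
  classical
  set S : Finset GridEdge := (Finset.univ : Finset Bool) ×ˢ (Finset.Icc (-(2 * N : ℤ)) (2 * N)) ×ˢ
      (Finset.Icc (-(2 * N : ℤ)) (2 * N)) with hS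
  have hL : 0 < ε * N := by positivity
  have hN1 : (1 : ℝ) ≤ N := by exact_mod_cast hN
  have hcard : (S.card : ℝ) ≤ 50 * N ^ 2 := by
    have h1 : (Finset.Icc (-(2 * N : ℤ)) (2 * N)).card = 4 * N + 1 := by
      rw [Int.card_Icc]; omega
    rw [hS, Finset.card_product, Finset.card_product, h1]
    simp only [Finset.card_univ, Fintype.card_bool]
    push_cast
    nlinarith
  set g : GridEdge × ℝ → ℝ := fun z =>
    if z.1 ∈ S then deriv (fun t => gridTent ε N (edgePoint ε z.1 t)) z.2 else 0 with hg
  have hgm : Measurable g := measurable_from_prod_countable_right fun e => by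
    by_cases he : e ∈ S
    · simp only [hg, he, if_true]; exact measurable_deriv _
    · simp only [hg, he, if_false]; exact measurable_const
  have hgb : ∀ z, |g z| ≤ (ε * N)⁻¹ := fun z => by
    by_cases he : z.1 ∈ S
    · simp only [hg, he, if_true]
      have := norm_deriv_le_of_lipschitz (x₀ := z.2) (lipschitzWith_gridTent_edge hε hN z.1)
      rwa [Real.coe_toNNReal _ (inv_nonneg.2 hL.le)] at this
    · simp only [hg, he, if_false, abs_zero]; positivity
  obtain ⟨m1, m2⟩ := memLp_two_of_finset_edges hε (measurable_onEdges (continuous_gridTent ε N)) S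
    (fun z => abs_gridTent_le hε N _)
    (fun e he t ht => gridTent_edge_eq_zero hε hN he (Ioo_subset_Icc_self ht))
  obtain ⟨k1, k2⟩ := memLp_two_of_finset_edges hε hgm S hgb
    (fun e he t _ => by simp only [hg, he, if_false])
  refine ⟨g, ⟨m1, k1, fun e t ht => ?_⟩, m2.trans ?_, k2.trans ?_⟩
  · by_cases he : e ∈ S
    · simp only [hg, he, if_true]
      have := ((lipschitzWith_gridTent_edge hε hN e).lipschitzOnWith
        (s := uIcc 0 t)).absolutelyContinuousOnInterval.integral_deriv_eq_sub
      rw [this]; ring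
    · simp only [hg, he, if_false, intervalIntegral.integral_zero, add_zero]
      rw [gridTent_edge_eq_zero hε hN he ht,
        gridTent_edge_eq_zero hε hN he (left_mem_Icc.2 hε.le)]
  · rw [one_pow, one_mul]; gcongr
  · calc ((ε * N)⁻¹) ^ 2 * (S.card * ε) ≤ ((ε * N)⁻¹) ^ 2 * (50 * N ^ 2 * ε) := by gcongr
      _ = 50 / ε := by field_simp

theorem half_le_gridTent {ε : ℝ} (hε : 0 < ε) {N : ℕ} (hN : 0 < N) {w : ℤ × ℤ}
    (hw : 2 * (|w.1| + |w.2|) ≤ N) : 1 / 2 ≤ gridTent ε N (gridVertex ε w) := by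
  have hL : 0 < ε * N := by positivity
  refine le_max_of_le_right ?_
  have h : 2 * (|(w.1 : ℝ)| + |(w.2 : ℝ)|) ≤ N := by exact_mod_cast hw
  have : (|ε * (w.1 : ℝ)| + |ε * (w.2 : ℝ)|) / (ε * N) ≤ 1 / 2 := by
    rw [abs_mul, abs_mul, abs_of_pos hε, div_le_iff₀ hL]
    nlinarith
  simp only [gridVertex]
  linarith

end Tent

/-- The energy takes negative values at every mass. -/
theorem exists_pairEnergy_neg {ε p q α β μ : ℝ} (hε : 0 < ε) (hp : 2 < p) (hq : q ∈ Ioo (2 : ℝ) 4)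
    (hα : 0 < α) (hβ : 0 < β) {W : Set (ℤ × ℤ)} (hW : IsZ2PeriodicLattice W) (hne : W.Nonempty)
    (hμ : 0 < μ) :
    ∃ u g, GridPair ε u g ∧ gridMass ε u = μ ∧ pairEnergy ε p q α β W u g < 0 := by
  obtain ⟨D, hD, hper⟩ := hW.exists_square_period
  obtain ⟨w₀, hw₀⟩ := hne
  obtain ⟨hq2, hq4⟩ := hq
  -- The factor `A` makes the `K²` translates `w₀ + D k`, `k ∈ [0, K)²`, lie in the `ℓ¹` ball of
  -- radius `N / 2` with `N = A K`, where the tent is at least `1/2`.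
  set A : ℕ := (2 * (|w₀.1| + |w₀.2| + 2 * D)).toNat with hA
  have hAz : (A : ℤ) = 2 * (|w₀.1| + |w₀.2| + 2 * D) := Int.toNat_of_nonneg (by positivity)
  have hA0 : 0 < A := by zify; rw [hAz]; positivity
  have hA0' : (0 : ℝ) < A := by exact_mod_cast hA0
  -- The tent has mass at most `50 (A K)² ε`, so the factor normalising it to mass `μ` is at least
  -- `c₀ / K`.
  set c₀ : ℝ := √(μ / (50 * A ^ 2 * ε)) with hc₀
  have hc₀pos : 0 < c₀ := by positivity
  set C : ℝ := β / q * (c₀ ^ (q - 2) * (1 / 2) ^ q) with hC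
  have hCpos : 0 < C := by positivity
  -- Here `q < 4` is decisive: `C K ^ (4 - q)` exceeds `25 / ε`, the bound for half the kinetic term
  -- of the tent.
  obtain ⟨K, hKbig, hK0⟩ := (((tendsto_rpow_atTop (show 0 < 4 - q by linarith)).comp
    tendsto_natCast_atTop_atTop).eventually_gt_atTop (25 / ε / C)).and
    (Filter.eventually_gt_atTop 0) |>.exists
  simp only [Function.comp_apply] at hKbig
  rw [div_lt_iff₀ hCpos] at hKbig
  have hK0' : (0 : ℝ) < K := by exact_mod_cast hK0
  set N : ℕ := A * K
  have hN : 0 < N := by positivity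
  obtain ⟨g, hpair, hmass, hkin⟩ := exists_gridPair_gridTent hε hN
  set u := gridTent ε N
  have hm0 : 0 < gridMass ε u := by
    refine lt_of_le_of_ne (gridMass_nonneg ε u) fun h0 => ?_
    have h1 := hpair.sq_le hε (gridVertex ε 0)
    have h2 : (1 / 2 : ℝ) ≤ u (gridVertex ε 0) := half_le_gridTent hε hN (by simp)
    rw [← h0] at h1
    simp [gridBound] at h1
    rw [h1] at h2; norm_num at h2
  have hP : (K : ℝ) ^ 2 * (1 / 2) ^ q ≤ ∫ w in W, |u (gridVertex ε w)| ^ q ∂Measure.count := by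
    have hint : IntegrableOn (fun w => |u (gridVertex ε w)| ^ q) W Measure.count :=
      ((hpair.memLp_vertex_restrict hε W).1.integrable_abs_rpow_of_bound
        (Filter.Eventually.of_forall fun w => abs_gridTent_le hε N _) hq2.le).1
    set T : Finset (ℤ × ℤ) := (Finset.range K ×ˢ Finset.range K).image
      fun k => w₀ + D • ((k.1 : ℤ), (k.2 : ℤ)) with hT
    have hTcard : T.card = K ^ 2 := by
      rw [hT, Finset.card_image_of_injective, Finset.card_product, Finset.card_range, sq]
      rintro ⟨a, b⟩ ⟨c, d⟩ h
      simpa [hD.ne'] using h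
    have hTW : (T : Set (ℤ × ℤ)) ⊆ W := by
      intro w hw
      obtain ⟨k, -, rfl⟩ := Finset.mem_image.1 (Finset.mem_coe.1 hw)
      exact (hper _ _).2 hw₀
    refine le_trans ?_ (setIntegral_mono_set hint
      (Filter.Eventually.of_forall fun w => by positivity) (LE.le.eventuallyLE hTW))
    have hc : ∫ w in (T : Set (ℤ × ℤ)), ((1 / 2 : ℝ) ^ q) ∂Measure.count =
        (K : ℝ) ^ 2 * (1 / 2) ^ q := by
      rw [setIntegral_const, Measure.real, Measure.count_apply_finset, hTcard]
      simp
    rw [← hc]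
    refine setIntegral_mono_on (integrableOn_const (by simp)) (hint.mono_set hTW) T.measurableSet
      fun w hw => ?_
    refine Real.rpow_le_rpow (by norm_num) ?_ (by linarith)
    refine (half_le_gridTent hε hN ?_).trans (le_abs_self _)
    obtain ⟨⟨a, b⟩, hk, rfl⟩ := Finset.mem_image.1 (Finset.mem_coe.1 hw)
    simp only [Finset.mem_product, Finset.mem_range] at hk
    have ha : |w₀.1 + D * (a : ℤ)| ≤ |w₀.1| + D * a := by
      refine (abs_add_le _ _).trans_eq ?_; rw [abs_of_nonneg (by positivity : 0 ≤ D * (a : ℤ))]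
    have hb : |w₀.2 + D * (b : ℤ)| ≤ |w₀.2| + D * b := by
      refine (abs_add_le _ _).trans_eq ?_; rw [abs_of_nonneg (by positivity : 0 ≤ D * (b : ℤ))]
    have ha' : D * (a : ℤ) ≤ D * K := by gcongr; exact_mod_cast hk.1.le
    have hb' : D * (b : ℤ) ≤ D * K := by gcongr; exact_mod_cast hk.2.le
    have hw1 : |w₀.1| + |w₀.2| ≤ (|w₀.1| + |w₀.2|) * K :=
      le_mul_of_one_le_right (by positivity) (by exact_mod_cast hK0)
    simp only [Prod.fst_add, Prod.snd_add, Prod.smul_fst, Prod.smul_snd, smul_eq_mul]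
    have hNz : ((N : ℕ) : ℤ) = 2 * (|w₀.1| + |w₀.2| + 2 * D) * K := by
      rw [← hAz]; push_cast [N]; rfl
    rw [hNz]
    linarith
  set c : ℝ := √(μ / gridMass ε u) with hcdef
  have hcpos : 0 < c := by positivity
  have hcsq : c ^ 2 = μ / gridMass ε u := Real.sq_sqrt (by positivity)
  have hcle : c₀ / K ≤ c := by
    rw [hcdef]
    refine Real.le_sqrt_of_sq_le ?_
    rw [div_pow, hc₀, Real.sq_sqrt (by positivity), div_div]
    gcongr
    refine hmass.trans_eq ?_
    push_cast [N]; ring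
  refine ⟨_, _, hpair.smul c, ?_, ?_⟩
  · rw [gridMass_const_mul, hcsq, div_mul_cancel₀ _ hm0.ne']
  · rw [pairEnergy_const_mul hcpos.le]
    have hNp : 0 ≤ α / p * (c ^ p * ∫ z, |onEdges ε u z| ^ p ∂gridMeasure ε) := by
      have : 0 ≤ ∫ z, |onEdges ε u z| ^ p ∂gridMeasure ε := integral_nonneg fun _ => by positivity
      positivity
    have hcq : c ^ q = c ^ 2 * c ^ (q - 2) := by
      rw [← Real.rpow_natCast, ← Real.rpow_add hcpos]; congr 1; push_cast; ring
    have hK2 : (K : ℝ) ^ (4 - q) = (K : ℝ) ^ 2 / (K : ℝ) ^ (q - 2) := by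
      rw [← Real.rpow_natCast, ← Real.rpow_sub hK0']; congr 1; push_cast; ring
    have h1 : c₀ ^ (q - 2) / (K : ℝ) ^ (q - 2) ≤ c ^ (q - 2) := by
      rw [← Real.div_rpow hc₀pos.le hK0'.le]
      exact Real.rpow_le_rpow (by positivity) hcle (by linarith)
    have h2 : 25 / ε < β / q * (c ^ (q - 2) * ((K : ℝ) ^ 2 * (1 / 2) ^ q)) := by
      refine hKbig.trans_le ?_
      rw [hK2, hC]
      calc (K : ℝ) ^ 2 / (K : ℝ) ^ (q - 2) * (β / q * (c₀ ^ (q - 2) * (1 / 2) ^ q))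
          = β / q * ((c₀ ^ (q - 2) / (K : ℝ) ^ (q - 2)) * ((K : ℝ) ^ 2 * (1 / 2) ^ q)) := by ring
        _ ≤ _ := by gcongr
    have h3 : β / q * (c ^ (q - 2) * ((K : ℝ) ^ 2 * (1 / 2) ^ q)) ≤
        β / q * (c ^ (q - 2) * ∫ w in W, |u (gridVertex ε w)| ^ q ∂Measure.count) := by gcongr
    have h4 : 1 / 2 * gridKinetic ε g ≤ 25 / ε := by
      have : 50 / ε = 2 * (25 / ε) := by ring
      linarith
    rw [hcq]
    have h5 := mul_lt_mul_of_pos_left (h4.trans_lt (h2.trans_le h3)) (pow_pos hcpos 2)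
    linarith

/-! ### Coercivity. -/

/-- Subcritical growth of the nonlinear terms bounds the kinetic term. -/
theorem exists_kinetic_bound {ε p q m C₁ C₂ : ℝ} (hε : 0 < ε) (hp : p < 6) (hq : q < 4)
    (hm : 0 < m) (h₁ : 0 ≤ C₁) (h₂ : 0 ≤ C₂) :
    ∃ K, ∀ k, 0 ≤ k → 1 / 2 * k ≤ C₁ * √(gridBound ε m k) ^ (p - 2) +
      C₂ * (√(gridBound ε m k) ^ (q - 2) * gridBound ε m k) → k ≤ K := by
  -- With `c = √B ≥ 1`, both nonlinear terms are at most a constant times `c ^ r`, and `r < 4`.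
  set r : ℝ := max (p - 2) q with hr
  have hr4 : r < 4 := max_lt (by linarith) hq
  obtain ⟨c₀, hc₀⟩ := ((tendsto_rpow_atTop (show 0 < 4 - r by linarith)).eventually_gt_atTop
    (32 * m * (C₁ + C₂))).exists_forall_of_atTop
  -- Above `c₁` one has `ε⁻¹ m ≤ c² / 2`, so `√(m k) ≥ c² / 4` and `m k ≥ c⁴ / 16`. Together with `k
  -- ≤ 2 (C₁ + C₂) c ^ r` this gives `c ^ (4 - r) ≤ 32 m (C₁ + C₂)`, against the choice of `c₀`.
  set c₁ : ℝ := max c₀ (max 1 √(2 * (ε⁻¹ * m))) with hc₁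
  refine ⟨c₁ ^ 4 / (4 * m), fun k hk h => ?_⟩
  set B := gridBound ε m k with hB
  have hB0 : 0 ≤ B := gridBound_nonneg hε hm.le k
  have hBdef : B = ε⁻¹ * m + 2 * √(m * k) := rfl
  have hsq : √(m * k) ^ 2 = m * k := Real.sq_sqrt (by positivity)
  set c := √B with hc
  have hcB : c ^ 2 = B := Real.sq_sqrt hB0
  rcases le_or_gt c₁ c with hcc | hcc
  · exfalso
    have hc1 : 1 ≤ c := (le_max_left _ _).trans ((le_max_right _ _).trans hcc)
    have hcpos : 0 < c := by linarith
    have hca : 2 * (ε⁻¹ * m) ≤ c ^ 2 := by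
      have := (le_max_right _ _).trans ((le_max_right _ _).trans hcc)
      exact (Real.sqrt_le_left hcpos.le).1 this
    have h3 := hc₀ c ((le_max_left _ _).trans hcc)
    have h4 : c ^ 2 / 4 ≤ √(m * k) := by rw [hcB] at hca ⊢; linarith
    have h5 : c ^ 4 / 16 ≤ m * k := by
      rw [← hsq]
      calc c ^ 4 / 16 = (c ^ 2 / 4) ^ 2 := by ring
        _ ≤ _ := by gcongr
    have h6 : c ^ (p - 2) ≤ c ^ r := Real.rpow_le_rpow_of_exponent_le hc1 (le_max_left _ _)
    have h7 : c ^ (q - 2) * B ≤ c ^ r := by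
      rw [← hcB, ← Real.rpow_add_natCast hcpos.ne']
      refine Real.rpow_le_rpow_of_exponent_le hc1 ?_
      push_cast; rw [sub_add_cancel]; exact le_max_right _ _
    have h8 : 1 / 2 * k ≤ (C₁ + C₂) * c ^ r := by
      refine h.trans ?_
      rw [add_mul]; gcongr
    have h9 : c ^ 4 ≤ 32 * m * (C₁ + C₂) * c ^ r := by
      have := mul_le_mul_of_nonneg_left h8 hm.le
      nlinarith
    have h10 : c ^ 4 = c ^ (4 - r) * c ^ r := by
      rw [← Real.rpow_add hcpos, sub_add_cancel]; exact_mod_cast (Real.rpow_natCast c 4).symm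
    rw [h10] at h9
    exact absurd (le_of_mul_le_mul_right h9 (by positivity)) (not_le.2 h3)
  · have h1 : B ≤ c₁ ^ 2 := by rw [← hcB]; gcongr
    have h2 : √(m * k) ≤ c₁ ^ 2 / 2 := by
      have : 0 ≤ ε⁻¹ * m := by positivity
      linarith
    have h3 : m * k ≤ c₁ ^ 4 / 4 := by
      rw [← hsq]
      calc √(m * k) ^ 2 ≤ (c₁ ^ 2 / 2) ^ 2 := by gcongr
        _ = _ := by ring
    rw [le_div_iff₀ (by positivity)]; linarith

/-! ### Compactness and splitting of bounded sequences. -/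

instance (ε : ℝ) : SFinite (gridMeasure ε) := by
  unfold gridMeasure; infer_instance

/-- The increment of `u` along an edge is `u'` tested against an indicator in `L²`; weak convergence
of derivatives thus gives pointwise convergence of increments. -/
theorem integral_mul_indicator_edge {ε : ℝ} {g : GridEdge × ℝ → ℝ}
    (hg : MemLp g 2 (gridMeasure ε)) (e : GridEdge) {t : ℝ} (ht : t ∈ Icc 0 ε) :
    MemLp (({e} ×ˢ Ioo 0 t : Set (GridEdge × ℝ)).indicator fun _ => (1 : ℝ)) 2 (gridMeasure ε) ∧
    ∫ z, g z * ({e} ×ˢ Ioo 0 t : Set (GridEdge × ℝ)).indicator (fun _ => (1 : ℝ)) z ∂gridMeasure ε =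
      ∫ s in (0 : ℝ)..t, g (e, s) := by
  have hm : MeasurableSet ({e} ×ˢ Ioo 0 t : Set (GridEdge × ℝ)) :=
    (measurableSet_singleton e).prod measurableSet_Ioo
  have hmem : MemLp (({e} ×ˢ Ioo 0 t : Set (GridEdge × ℝ)).indicator fun _ => (1 : ℝ)) 2
      (gridMeasure ε) := by
    refine memLp_indicator_const 2 hm 1 (Or.inr ?_)
    rw [gridMeasure, Measure.prod_prod, Measure.count_singleton, one_mul]
    exact measure_ne_top _ _
  refine ⟨hmem, ?_⟩
  have h1 := (hg.integrable_mul hmem).hasSum_gridEdge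
  have h2 := hasSum_single (f := fun e' : GridEdge => ∫ s in Ioo 0 ε, (g *
    ({e} ×ˢ Ioo 0 t : Set (GridEdge × ℝ)).indicator (fun _ => (1 : ℝ))) (e', s)) e fun e' he' => by
      simp [Pi.mul_apply, indicator, he']
  refine (h1.unique h2).trans ?_
  have h3 : ∀ s, (g * ({e} ×ˢ Ioo 0 t : Set (GridEdge × ℝ)).indicator (fun _ => (1 : ℝ))) (e, s) =
      (Ioo 0 t).indicator (fun s => g (e, s)) s := fun s => by
    by_cases hs : s ∈ Ioo 0 t
    · rw [Pi.mul_apply, indicator_of_mem (by simpa using hs), indicator_of_mem hs, mul_one]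
    · rw [Pi.mul_apply, indicator_of_notMem (by simpa using hs), indicator_of_notMem hs, mul_zero]
  simp only [h3]
  rw [setIntegral_indicator measurableSet_Ioo,
    inter_eq_self_of_subset_right (Ioo_subset_Ioo_right ht.2), intervalIntegral.integral_of_le ht.1,
    integral_Ioc_eq_integral_Ioo]

/-- Bounded sequences in `H¹` have subsequences that converge pointwise, with derivatives that
converge weakly. -/
theorem exists_subseq_tendsto_gridPair {ε m K : ℝ} (hε : 0 < ε) {u : ℕ → Grid ε → ℝ}
    {g : ℕ → GridEdge × ℝ → ℝ} (h : ∀ n, GridPair ε (u n) (g n)) (hm : ∀ n, gridMass ε (u n) ≤ m)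
    (hK : ∀ n, gridKinetic ε (g n) ≤ K) :
    ∃ U G, GridPair ε U G ∧ ∃ ns : ℕ → ℕ, StrictMono ns ∧
      (∀ x, Filter.Tendsto (fun n => u (ns n) x) Filter.atTop (nhds (U x))) ∧
      ∀ f, MemLp f 2 (gridMeasure ε) → Filter.Tendsto
        (fun n => ∫ z, g (ns n) z * f z ∂gridMeasure ε) Filter.atTop
        (nhds (∫ z, G z * f z ∂gridMeasure ε)) := by
  obtain ⟨G, hG, ns₁, hns₁, hlim₁⟩ :=
    exists_subseq_tendsto_integral_mul (fun n => (h n).memLp_right) hK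
  set M : ℝ := √(gridBound ε m K)
  have hM : ∀ n x, |u n x| ≤ M := fun n x =>
    Real.abs_le_sqrt (((h n).sq_le hε x).trans
      (gridBound_mono hε (gridMass_nonneg _ _) (hm n) (gridKinetic_nonneg _ _) (hK n)))
  -- The vertex values lie in a countable product of compact intervals, which yields one subsequence
  -- converging at all vertices; increments along edges supply the other points.
  have hcpt : IsCompact (Set.pi univ fun _ : ℤ × ℤ => Icc (-M) M) :=
    isCompact_univ_pi fun _ => isCompact_Icc
  obtain ⟨L, -, ns₂, hns₂, hlim₂⟩ := hcpt.tendsto_subseq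
    (x := fun n w => u (ns₁ n) (gridVertex ε w)) fun n w _ => abs_le.1 (hM _ _)
  rw [tendsto_pi_nhds] at hlim₂
  set ns := ns₁ ∘ ns₂
  have hvert : ∀ e : GridEdge, edgePoint ε e 0 = gridVertex ε e.2 := by
    rintro ⟨b, i, j⟩
    cases b <;> exact Subtype.ext (by simp [gridVertex, edgePoint])
  have hedge : ∀ (e : GridEdge), ∀ t ∈ Icc 0 ε, Filter.Tendsto
      (fun n => u (ns n) (edgePoint ε e t)) Filter.atTop
      (nhds (L e.2 + ∫ s in (0 : ℝ)..t, G (e, s))) := fun e t ht => by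
    have h1 := (hlim₁ _ (integral_mul_indicator_edge hG e ht).1).comp hns₂.tendsto_atTop
    rw [(integral_mul_indicator_edge hG e ht).2] at h1
    refine ((hlim₂ e.2).add h1).congr fun n => ?_
    simp only [Function.comp_apply, ns]
    rw [(integral_mul_indicator_edge (h _).memLp_right e ht).2, (h _).eq_primitive e t ht, hvert]
  have hex : ∀ x, ∃ l, Filter.Tendsto (fun n => u (ns n) x) Filter.atTop (nhds l) := fun x => by
    obtain ⟨e, t, ht, rfl⟩ := exists_edgePoint_eq hε x
    exact ⟨_, hedge e t (Ico_subset_Icc_self ht)⟩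
  choose U hU using hex
  refine ⟨U, G, ⟨memLp_two_of_tendsto (fun n => (h (ns n)).memLp_left) (fun n => hm (ns n))
    (Filter.Eventually.of_forall fun z => hU _), hG, fun e t ht => ?_⟩, ns, hns₁.comp hns₂, hU,
    fun f hf => (hlim₁ f hf).comp hns₂.tendsto_atTop⟩
  have h1 := tendsto_nhds_unique (hU _) (hedge e t ht)
  have h2 := tendsto_nhds_unique (hU _) (hedge e 0 (left_mem_Icc.2 hε.le))
  rw [h1, h2, intervalIntegral.integral_same, add_zero]

/-- Splitting of mass and energy along a converging bounded sequence. -/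
theorem tendsto_pairEnergy_sub {ε m K p q α β : ℝ} (hε : 0 < ε) (hp : 2 ≤ p) (hq : 2 ≤ q)
    (W : Set (ℤ × ℤ)) {u : ℕ → Grid ε → ℝ}
    {g : ℕ → GridEdge × ℝ → ℝ} (h : ∀ n, GridPair ε (u n) (g n)) (hm : ∀ n, gridMass ε (u n) ≤ m)
    (hK : ∀ n, gridKinetic ε (g n) ≤ K) {U : Grid ε → ℝ} {G : GridEdge × ℝ → ℝ}
    (hUG : GridPair ε U G)
    (hU : ∀ x, Filter.Tendsto (fun n => u n x) Filter.atTop (nhds (U x)))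
    (hG : ∀ f, MemLp f 2 (gridMeasure ε) → Filter.Tendsto
        (fun n => ∫ z, g n z * f z ∂gridMeasure ε) Filter.atTop
        (nhds (∫ z, G z * f z ∂gridMeasure ε))) :
    Filter.Tendsto (fun n => gridMass ε (u n) - gridMass ε U - gridMass ε (fun x => u n x - U x))
      Filter.atTop (nhds 0) ∧
    Filter.Tendsto (fun n => pairEnergy ε p q α β W (u n) (g n) - pairEnergy ε p q α β W U G -
      pairEnergy ε p q α β W (fun x => u n x - U x) (fun z => g n z - G z))
      Filter.atTop (nhds 0) := by
  have hd : ∀ n, GridPair ε (fun x => u n x - U x) (fun z => g n z - G z) := fun n =>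
    (h n).sub hUG hε
  set M : ℝ := √(gridBound ε m K)
  have hM : ∀ n x, |u n x| ≤ M := fun n x =>
    Real.abs_le_sqrt (((h n).sq_le hε x).trans
      (gridBound_mono hε (gridMass_nonneg _ _) (hm n) (gridKinetic_nonneg _ _) (hK n)))
  have hUM : ∀ x, |U x| ≤ M := fun x => le_of_tendsto' (hU x).abs fun n => hM n x
  -- Weakened to `2 * M` so that `U` and the differences share one bound.
  have hUM' : ∀ x, |U x| ≤ 2 * M := fun x => by linarith [hUM x, abs_nonneg (U x)]
  have hdM : ∀ n x, |u n x - U x| ≤ 2 * M := fun n x =>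
    (abs_sub _ _).trans (by linarith [hUM x, hM n x])
  have hd0 : ∀ x, Filter.Tendsto (fun n => u n x - U x) Filter.atTop (nhds 0) := fun x => by
    simpa using (hU x).sub_const (U x)
  have hbound : ∀ {X : Type} [MeasurableSpace X] {ν : Measure X} {a b : X → ℝ},
      MemLp a 2 ν → MemLp b 2 ν →
      ∫ x, (a x - b x) ^ 2 ∂ν ≤ 2 * ∫ x, a x ^ 2 ∂ν + 2 * ∫ x, b x ^ 2 ∂ν := by
    intro X _ ν a b ha hb
    rw [← integral_const_mul, ← integral_const_mul, ← integral_add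
      (ha.integrable_sq.const_mul 2) (hb.integrable_sq.const_mul 2)]
    refine integral_mono (ha.sub hb).integrable_sq
      ((ha.integrable_sq.const_mul 2).add (hb.integrable_sq.const_mul 2)) fun x => ?_
    show (a x - b x) ^ 2 ≤ 2 * a x ^ 2 + 2 * b x ^ 2
    nlinarith [sq_nonneg (a x + b x)]
  have hdm : ∀ n, ∫ z, onEdges ε (fun x => u n x - U x) z ^ 2 ∂gridMeasure ε ≤
      2 * m + 2 * gridMass ε U := fun n => by
    have := hbound (h n).memLp_left hUG.memLp_left
    have h' := hm n
    unfold gridMass at h' ⊢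
    refine this.trans ?_
    linarith
  have hedge : ∀ r : ℝ, 2 ≤ r → Filter.Tendsto (fun n => ∫ z, |onEdges ε (u n) z| ^ r ∂gridMeasure ε
      - ∫ z, |onEdges ε U z| ^ r ∂gridMeasure ε
      - ∫ z, |onEdges ε (fun x => u n x - U x) z| ^ r ∂gridMeasure ε) Filter.atTop (nhds 0) := by
    intro r hr
    have := tendsto_integral_abs_rpow_add_sub (M := 2 * M) hr hUG.memLp_left
      (fun n => (hd n).memLp_left) hdm (Filter.Eventually.of_forall fun z => hd0 _)
      (Filter.Eventually.of_forall fun z => hUM' _)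
      (fun n => Filter.Eventually.of_forall fun z => hdM n _)
    simpa only [onEdges, add_sub_cancel] using this
  have hvertex : Filter.Tendsto (fun n => ∫ w in W, |u n (gridVertex ε w)| ^ q ∂Measure.count
      - ∫ w in W, |U (gridVertex ε w)| ^ q ∂Measure.count
      - ∫ w in W, |u n (gridVertex ε w) - U (gridVertex ε w)| ^ q ∂Measure.count)
      Filter.atTop (nhds 0) := by
    have hdv : ∀ n, ∫ w in W, (u n (gridVertex ε w) - U (gridVertex ε w)) ^ 2 ∂Measure.count ≤
        2 * gridBound ε m K + 2 * gridBound ε (gridMass ε U) (gridKinetic ε G) := fun n => by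
      have h1 := hbound ((h n).memLp_vertex_restrict hε W).1 (hUG.memLp_vertex_restrict hε W).1
      have h2 := ((h n).memLp_vertex_restrict hε W).2.trans
        (gridBound_mono hε (gridMass_nonneg _ _) (hm n) (gridKinetic_nonneg _ _) (hK n))
      have h3 := (hUG.memLp_vertex_restrict hε W).2
      linarith
    have := tendsto_integral_abs_rpow_add_sub (M := 2 * M) hq (hUG.memLp_vertex_restrict hε W).1
      (fun n => ((hd n).memLp_vertex_restrict hε W).1) hdv
      (Filter.Eventually.of_forall fun w => hd0 _) (Filter.Eventually.of_forall fun w => hUM' _)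
      (fun n => Filter.Eventually.of_forall fun w => hdM n _)
    simpa only [add_sub_cancel] using this
  have hkin : Filter.Tendsto (fun n => gridKinetic ε (g n) - gridKinetic ε G -
      gridKinetic ε (fun z => g n z - G z)) Filter.atTop (nhds 0) := by
    -- The identity `g² - G² - (g - G)² = 2 (g G - G²)` makes weak convergence, tested against `G`
    -- itself, sufficient.
    have h1 := ((hG G hUG.memLp_right).sub_const (∫ z, G z * G z ∂gridMeasure ε)).const_mul 2
    rw [sub_self, mul_zero] at h1
    refine h1.congr fun n => ?_
    have i1 := (h n).memLp_right.integrable_mul hUG.memLp_right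
    have i2 := (h n).memLp_right.integrable_sq
    have i3 := hUG.memLp_right.integrable_sq
    have i4 := (hd n).memLp_right.integrable_sq
    have i5 : Integrable (fun z => G z * G z) (gridMeasure ε) := by simpa only [sq] using i3
    unfold gridKinetic
    rw [← integral_sub i2 i3, ← integral_sub (f := fun z => g n z ^ 2 - G z ^ 2) (i2.sub i3) i4,
      ← integral_sub (f := fun z => g n z * G z) i1 i5, ← integral_const_mul]
    congr 1; ext z; ring
  constructor
  · simpa only [gridMass, Real.rpow_two, sq_abs] using hedge 2 le_rfl
  · have h1 := ((hkin.const_mul (1 / 2)).sub ((hedge p hp).const_mul (α / p))).sub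
      (hvertex.const_mul (β / q))
    simp only [mul_zero, sub_zero] at h1
    refine h1.congr fun n => ?_
    unfold pairEnergy
    ring

/-! ### Minimization at fixed mass. -/

section GroundState

variable {ε p q α β μ : ℝ} {W : Set (ℤ × ℤ)}

/-- The energies of the pairs of mass `μ`. -/
def pairEnergies (ε p q α β : ℝ) (W : Set (ℤ × ℤ)) (μ : ℝ) : Set ℝ :=
  {E | ∃ u g, GridPair ε u g ∧ gridMass ε u = μ ∧ pairEnergy ε p q α β W u g = E}

/-- Nonpositive energy bounds the kinetic term by the nonlinear ones, and the sup bound puts these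
in the form required by `exists_kinetic_bound`. -/
theorem exists_kinetic_le (hε : 0 < ε) (hp : p ∈ Ioo (2 : ℝ) 6) (hq : q ∈ Ioo (2 : ℝ) 4)
    (hα : 0 < α) (hβ : 0 < β) (W : Set (ℤ × ℤ)) (hμ : 0 < μ) :
    ∃ K, ∀ u g, GridPair ε u g → gridMass ε u = μ → pairEnergy ε p q α β W u g ≤ 0 →
      gridKinetic ε g ≤ K := by
  have hp0 : 0 < p := by linarith [hp.1]
  have hq0 : 0 < q := by linarith [hq.1]
  obtain ⟨K, hK⟩ := exists_kinetic_bound (C₁ := α / p * μ) (C₂ := β / q) hε hp.2 hq.2 hμ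
    (by positivity) (by positivity)
  refine ⟨K, fun u g h hm hE => hK _ (gridKinetic_nonneg _ _) ?_⟩
  have := h.le_pairEnergy hε hp.1.le hq.1.le hα.le hβ.le W (Real.sqrt_nonneg _)
    fun x => Real.abs_le_sqrt (h.sq_le hε x)
  rw [hm] at this
  linarith

theorem bddBelow_pairEnergies (hε : 0 < ε) (hp : p ∈ Ioo (2 : ℝ) 6) (hq : q ∈ Ioo (2 : ℝ) 4)
    (hα : 0 < α) (hβ : 0 < β) (W : Set (ℤ × ℤ)) (hμ : 0 < μ) :
    BddBelow (pairEnergies ε p q α β W μ) := by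
  have hp0 : 0 < p := by linarith [hp.1]
  have hq0 : 0 < q := by linarith [hq.1]
  obtain ⟨K, hK⟩ := exists_kinetic_le hε hp hq hα hβ W hμ
  -- The `0` covers pairs of positive energy, for which no kinetic bound is at hand.
  refine ⟨min 0 (- (α / p * (√(gridBound ε μ K) ^ (p - 2) * μ)) -
    β / q * (√(gridBound ε μ K) ^ (q - 2) * gridBound ε μ K)), ?_⟩
  rintro _ ⟨u, g, h, hm, rfl⟩
  rcases le_total 0 (pairEnergy ε p q α β W u g) with hE | hE
  · exact (min_le_left _ _).trans hE
  · refine (min_le_right _ _).trans ?_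
    have hb : gridBound ε (gridMass ε u) (gridKinetic ε g) ≤ gridBound ε μ K :=
      gridBound_mono hε (gridMass_nonneg _ _) hm.le (gridKinetic_nonneg _ _) (hK u g h hm hE)
    have h1 := h.le_pairEnergy hε hp.1.le hq.1.le hα.le hβ.le W (Real.sqrt_nonneg _)
      fun x => Real.abs_le_sqrt ((h.sq_le hε x).trans hb)
    have h2 : β / q * (√(gridBound ε μ K) ^ (q - 2) *
        gridBound ε (gridMass ε u) (gridKinetic ε g)) ≤
        β / q * (√(gridBound ε μ K) ^ (q - 2) * gridBound ε μ K) := by gcongr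
    have h3 := gridKinetic_nonneg ε g
    rw [hm] at h1 h2
    linarith

/-- Strict subhomogeneity: energies at smaller masses lie above the linear interpolation of the
ground state level. -/
theorem mass_mul_le_pairEnergy (hε : 0 < ε) (hp : 2 < p) (hq : 2 < q)
    (hα : 0 < α) (hβ : 0 < β) (hμ : 0 < μ)
    {e : ℝ} (he : e ∈ lowerBounds (pairEnergies ε p q α β W μ))
    {u : Grid ε → ℝ} {g : GridEdge × ℝ → ℝ} (h : GridPair ε u g) (hm : gridMass ε u ≤ μ) :
    gridMass ε u / μ * e ≤ pairEnergy ε p q α β W u g ∧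
      (0 < gridMass ε u → gridMass ε u < μ →
        gridMass ε u / μ * e < pairEnergy ε p q α β W u g) := by
  rcases (gridMass_nonneg ε u).eq_or_lt with h0 | h0
  · refine ⟨?_, fun h' => absurd h0 h'.ne⟩
    have hz : ∀ x, |u x| ≤ 0 := fun x => by
      have := h.sq_le hε x
      rw [← h0] at this
      have h2 : u x ^ 2 ≤ 0 := by simpa [gridBound] using this
      have h3 : u x = 0 := pow_eq_zero_iff two_ne_zero |>.1 (le_antisymm h2 (sq_nonneg _))
      simp [h3]
    have h1 := h.le_pairEnergy hε hp.le hq.le hα.le hβ.le W le_rfl hz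
    rw [Real.zero_rpow (by linarith), Real.zero_rpow (by linarith)] at h1
    have := gridKinetic_nonneg ε g
    rw [← h0, zero_div, zero_mul]
    linarith
  · set P := ∫ z, |onEdges ε u z| ^ p ∂gridMeasure ε with hP
    set Q := ∫ w in W, |u (gridVertex ε w)| ^ q ∂Measure.count with hQ
    have hbd : ∀ x, |u x| ≤ √(gridBound ε (gridMass ε u) (gridKinetic ε g)) := fun x =>
      Real.abs_le_sqrt (h.sq_le hε x)
    have hQ0 : 0 ≤ Q := integral_nonneg fun _ => by positivity
    -- Strictness must come from the `p`-term, since `u` may vanish at every vertex of `W`.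
    have hP0 : 0 < P := by
      refine lt_of_le_of_ne (integral_nonneg fun _ => by positivity) fun hz => ?_
      rw [hP, eq_comm, integral_eq_zero_iff_of_nonneg (fun _ => by positivity)
        (h.memLp_left.integrable_abs_rpow_of_bound (Filter.Eventually.of_forall fun _ => hbd _)
          hp.le).1] at hz
      refine h0.ne' ?_
      rw [gridMass]
      refine integral_eq_zero_of_ae ?_
      filter_upwards [hz] with z hz
      have : |onEdges ε u z| = 0 :=
        ((Real.rpow_eq_zero_iff_of_nonneg (abs_nonneg _)).1 hz).1
      simp [abs_eq_zero.1 this]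
    -- Multiplication by `c ≥ 1` brings the mass to `μ`. As `p, q > 2`, the nonlinear terms grow by
    -- at least `c²`, so `e ≤ E(c u) ≤ c² E(u)`.
    set c := √(μ / gridMass ε u) with hc
    have hcsq : c ^ 2 = μ / gridMass ε u := Real.sq_sqrt (by positivity)
    have hc1 : 1 ≤ c := by
      rw [hc, Real.one_le_sqrt, one_le_div h0]; exact hm
    have hcpos : 0 < c := by linarith
    have hle : e ≤ pairEnergy ε p q α β W (fun x => c * u x) (fun z => c * g z) :=
      he ⟨_, _, h.smul c, by rw [gridMass_const_mul, hcsq, div_mul_cancel₀ _ h0.ne'], rfl⟩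
    rw [pairEnergy_const_mul hcpos.le, ← hP, ← hQ] at hle
    have hpow : ∀ r : ℝ, 2 < r → c ^ 2 ≤ c ^ r := fun r hr => by
      rw [← Real.rpow_two]; exact Real.rpow_le_rpow_of_exponent_le hc1 hr.le
    have hE : c ^ 2 * pairEnergy ε p q α β W u g = 1 / 2 * (c ^ 2 * gridKinetic ε g) -
        α / p * (c ^ 2 * P) - β / q * (c ^ 2 * Q) := by
      rw [pairEnergy]; ring
    have hQle : β / q * (c ^ 2 * Q) ≤ β / q * (c ^ q * Q) := by
      have := hpow q hq; gcongr
    have hmc : gridMass ε u / μ = (c ^ 2)⁻¹ := by rw [hcsq, inv_div]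
    rw [hmc]
    constructor
    · rw [inv_mul_le_iff₀ (by positivity), hE]
      have : α / p * (c ^ 2 * P) ≤ α / p * (c ^ p * P) := by
        have := hpow p hp; gcongr
      linarith
    · intro _ hlt
      rw [inv_mul_lt_iff₀ (by positivity), hE]
      have hc1' : 1 < c := by
        rw [hc, Real.lt_sqrt zero_le_one, one_pow, one_lt_div h0]; exact hlt
      have : α / p * (c ^ 2 * P) < α / p * (c ^ p * P) := by
        have : c ^ 2 < c ^ p := by
          rw [← Real.rpow_two]; exact Real.rpow_lt_rpow_of_exponent_lt hc1' hp
        gcongr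
      linarith

/-- Functions of uniformly negative energy do not vanish: a fixed part of the mass lies on
a single edge. -/
theorem exists_edge_mass_lower_bound (hε : 0 < ε) (hp : 2 < p) (hq : 2 < q) (hα : 0 < α)
    (hβ : 0 < β) (W : Set (ℤ × ℤ)) (μ K : ℝ) {c : ℝ} (hc : c < 0) :
    ∃ η, 0 < η ∧ ∀ u g, GridPair ε u g → gridMass ε u = μ → gridKinetic ε g ≤ K →
      pairEnergy ε p q α β W u g ≤ c → ∃ e, η ≤ ∫ s in Ioo 0 ε, onEdges ε u (e, s) ^ 2 := by
  -- `F η` bounds the energy from below when every edge mass is less than `η`. It is continuous with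
  -- `F 0 = 0`, hence exceeds `c < 0` for small `η`.
  set F : ℝ → ℝ := fun η => - (α / p * (√(gridBound ε η K) ^ (p - 2) * μ)) -
    β / q * (√(gridBound ε η K) ^ (q - 2) * gridBound ε μ K) with hF
  have hcont : Continuous F := by
    have h1 : Continuous fun η => √(gridBound ε η K) := by unfold gridBound; fun_prop
    have h2 : ∀ r : ℝ, 2 < r → Continuous fun η => √(gridBound ε η K) ^ (r - 2) := fun r hr =>
      h1.rpow_const fun _ => Or.inr (by linarith)
    exact (continuous_const.mul ((h2 p hp).mul_const _)).neg.sub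
      (continuous_const.mul ((h2 q hq).mul_const _))
  have hF0 : F 0 = 0 := by
    have : gridBound ε 0 K = 0 := by simp [gridBound]
    simp only [hF, this, Real.sqrt_zero]
    rw [Real.zero_rpow (by linarith), Real.zero_rpow (by linarith)]
    simp
  have hev : ∀ᶠ η in nhdsWithin (0 : ℝ) (Ioi 0), c < F η :=
    ((hcont.tendsto 0).mono_left nhdsWithin_le_nhds).eventually_const_lt (by rwa [hF0])
  obtain ⟨η, hη, hη0⟩ := (hev.and self_mem_nhdsWithin).exists
  refine ⟨η, hη0, fun u g h hm hk hE => ?_⟩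
  by_contra! hcon
  have hb : gridBound ε η (gridKinetic ε g) ≤ gridBound ε η K :=
    gridBound_mono hε (le_of_lt hη0) le_rfl (gridKinetic_nonneg _ _) hk
  have h1 := h.le_pairEnergy hε hp.le hq.le hα.le hβ.le W (Real.sqrt_nonneg _)
    fun x => Real.abs_le_sqrt ((h.sq_le_of_edge_le hε (fun e => (hcon e).le) x).trans hb)
  have hb2 : gridBound ε (gridMass ε u) (gridKinetic ε g) ≤ gridBound ε μ K :=
    gridBound_mono hε (gridMass_nonneg _ _) hm.le (gridKinetic_nonneg _ _) hk
  have h2 : β / q * (√(gridBound ε η K) ^ (q - 2) *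
      gridBound ε (gridMass ε u) (gridKinetic ε g)) ≤
      β / q * (√(gridBound ε η K) ^ (q - 2) * gridBound ε μ K) := by gcongr
  have h3 := gridKinetic_nonneg ε g
  rw [hm] at h1 h2
  simp only [hF] at hη
  linarith

/-- There is a minimizing sequence of which a fixed part of the mass stays on finitely many edges. -/
theorem exists_minimizing_sequence (hε : 0 < ε) (hp : p ∈ Ioo (2 : ℝ) 6) (hq : q ∈ Ioo (2 : ℝ) 4)
    (hα : 0 < α) (hβ : 0 < β) (hW : IsZ2PeriodicLattice W) (hμ : 0 < μ)
    (hne : (pairEnergies ε p q α β W μ).Nonempty) (hneg : sInf (pairEnergies ε p q α β W μ) < 0) :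
    ∃ (u : ℕ → Grid ε → ℝ) (g : ℕ → GridEdge × ℝ → ℝ) (K η : ℝ) (F : Finset GridEdge), 0 < η ∧
      (∀ n, GridPair ε (u n) (g n)) ∧ (∀ n, gridMass ε (u n) = μ) ∧
      (∀ n, gridKinetic ε (g n) ≤ K) ∧
      (∀ n, η ≤ ∑ e ∈ F, ∫ s in Ioo 0 ε, onEdges ε (u n) (e, s) ^ 2) ∧
      Filter.Tendsto (fun n => pairEnergy ε p q α β W (u n) (g n)) Filter.atTop
        (nhds (sInf (pairEnergies ε p q α β W μ))) := by
  set I := sInf (pairEnergies ε p q α β W μ)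
  obtain ⟨D, hD, hper⟩ := hW.exists_square_period
  obtain ⟨K, hK⟩ := exists_kinetic_le hε hp hq hα hβ W hμ
  obtain ⟨η, hη, hedge⟩ := exists_edge_mass_lower_bound hε hp.1 hq.1 hα hβ W μ K
    (show I / 2 < 0 by linarith)
  obtain ⟨x, -, hx, hxS⟩ := exists_seq_tendsto_sInf hne
    (bddBelow_pairEnergies hε hp hq hα hβ W hμ)
  obtain ⟨N, hN⟩ := Filter.eventually_atTop.1 (hx.eventually_lt_const (show I < I / 2 by linarith))
  choose u g hug hmass hE using hxS
  have hEn : ∀ n, pairEnergy ε p q α β W (u (n + N)) (g (n + N)) ≤ I / 2 := fun n => by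
    rw [hE]; exact (hN _ (by omega)).le
  have hkin : ∀ n, gridKinetic ε (g (n + N)) ≤ K := fun n =>
    hK _ _ (hug _) (hmass _) ((hEn n).trans (by linarith))
  choose e he using fun n => hedge _ _ (hug (n + N)) (hmass _) (hkin n) (hEn n)
  -- The shift is `D` times the quotients of the edge labels by `D`: it is a period, and the
  -- remainders place the chosen edge in the box `[0, D)²`.
  set a : ℕ → ℤ × ℤ := fun n => D • ((e n).2.1 / D, (e n).2.2 / D)
  refine ⟨fun n => u (n + N) ∘ gridShift ε (a n), fun n => g (n + N) ∘ edgeCoordShift (a n), K, η,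
    Finset.univ ×ˢ Finset.Ico 0 D ×ˢ Finset.Ico 0 D, hη, fun n => (hug _).shift _,
    fun n => (gridMass_gridShift _).trans (hmass _),
    fun n => (gridKinetic_edgeCoordShift _).trans_le (hkin n), fun n => ?_, ?_⟩
  · set f : GridEdge := ((e n).1, (e n).2.1 % D, (e n).2.2 % D)
    have hf : f ∈ (Finset.univ : Finset Bool) ×ˢ Finset.Ico 0 D ×ˢ Finset.Ico 0 D := by
      simp only [f, Finset.mem_product, Finset.mem_univ, Finset.mem_Ico, true_and]
      exact ⟨⟨Int.emod_nonneg _ hD.ne', Int.emod_lt_of_pos _ hD⟩,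
        Int.emod_nonneg _ hD.ne', Int.emod_lt_of_pos _ hD⟩
    have hfe : edgeShift (a n) f = e n := by
      show (((e n).1, (e n).2.1 % D + D * ((e n).2.1 / D),
        (e n).2.2 % D + D * ((e n).2.2 / D)) : GridEdge) = e n
      rw [Int.emod_add_mul_ediv, Int.emod_add_mul_ediv]
    refine le_trans ?_ (Finset.single_le_sum
      (f := fun e => ∫ s in Ioo 0 ε, onEdges ε (u (n + N) ∘ gridShift ε (a n)) (e, s) ^ 2)
      (fun _ _ => integral_nonneg fun _ => sq_nonneg _) hf)
    have : ∀ s, onEdges ε (u (n + N) ∘ gridShift ε (a n)) (f, s) = onEdges ε (u (n + N)) (e n, s) :=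
      fun s => by
        simp only [onEdges, Function.comp_apply, gridShift_edgePoint, hfe]
    simp only [this]
    exact he n
  · have h1 : ∀ n, pairEnergy ε p q α β W (u (n + N) ∘ gridShift ε (a n))
        (g (n + N) ∘ edgeCoordShift (a n)) = x (n + N) := fun n => by
      rw [pairEnergy_gridShift (fun w => hper _ w), hE]
    simp only [h1]
    exact hx.comp (Filter.tendsto_add_atTop_nat N)

/-- The infimum of the energy is attained. -/
theorem exists_pairEnergy_eq_sInf (hε : 0 < ε) (hp : p ∈ Ioo (2 : ℝ) 6) (hq : q ∈ Ioo (2 : ℝ) 4)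
    (hα : 0 < α) (hβ : 0 < β) (hW : IsZ2PeriodicLattice W) (hμ : 0 < μ)
    (hne : (pairEnergies ε p q α β W μ).Nonempty) (hneg : sInf (pairEnergies ε p q α β W μ) < 0) :
    sInf (pairEnergies ε p q α β W μ) ∈ pairEnergies ε p q α β W μ := by
  obtain ⟨u, g, K, η, F, hη, hug, hmass, hkin, hF, hlim⟩ :=
    exists_minimizing_sequence hε hp hq hα hβ hW hμ hne hneg
  set I := sInf (pairEnergies ε p q α β W μ) with hI
  have hbdd := bddBelow_pairEnergies hε hp hq hα hβ W hμ
  have hlow : I ∈ lowerBounds (pairEnergies ε p q α β W μ) := fun _ hE => csInf_le hbdd hE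
  obtain ⟨U, G, hUG, ns, hns, hU, hG⟩ :=
    exists_subseq_tendsto_gridPair hε hug (fun n => (hmass n).le) hkin
  obtain ⟨hm, hE⟩ := tendsto_pairEnergy_sub (p := p) (q := q) (α := α) (β := β) hε hp.1.le hq.1.le W
    (fun n => hug (ns n)) (fun n => (hmass (ns n)).le) (fun n => hkin (ns n)) hUG hU hG
  have hlim' := hlim.comp hns.tendsto_atTop
  have hmlim : Filter.Tendsto (fun n => gridMass ε (fun x => u (ns n) x - U x)) Filter.atTop
      (nhds (μ - gridMass ε U)) := by
    have := (tendsto_const_nhds (x := μ - gridMass ε U)).sub hm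
    rw [sub_zero] at this
    refine this.congr fun n => ?_
    rw [hmass]; ring
  have hUle : gridMass ε U ≤ μ :=
    sub_nonneg.1 (ge_of_tendsto' hmlim fun n => gridMass_nonneg _ _)
  -- On the finitely many edges of `F`, dominated convergence with the sup bound carries the mass
  -- `η` to the limit.
  have hUpos : 0 < gridMass ε U := by
    have hFlim : Filter.Tendsto
        (fun n => ∑ e ∈ F, ∫ s in Ioo 0 ε, onEdges ε (u (ns n)) (e, s) ^ 2) Filter.atTop
        (nhds (∑ e ∈ F, ∫ s in Ioo 0 ε, onEdges ε U (e, s) ^ 2)) := by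
      refine tendsto_finsetSum _ fun e _ => ?_
      refine tendsto_integral_of_dominated_convergence (fun _ => gridBound ε μ K)
        (fun n => ((hug _).memLp_left.gridEdge e).1.pow 2) (integrable_const _) (fun n => ?_) ?_
      · refine Filter.Eventually.of_forall fun s => ?_
        rw [Real.norm_of_nonneg (sq_nonneg _)]
        exact ((hug _).sq_le hε _).trans (gridBound_mono hε (gridMass_nonneg _ _) (hmass _).le
          (gridKinetic_nonneg _ _) (hkin _))
      · exact Filter.Eventually.of_forall fun s => (hU _).pow 2
    exact hη.trans_le ((ge_of_tendsto' hFlim fun n => hF _).trans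
      (sum_le_hasSum F (fun _ _ => integral_nonneg fun _ => sq_nonneg _)
        hUG.memLp_left.integrable_sq.hasSum_gridEdge))
  -- The remainder has energy at least its share of `I`, and its mass tends to `μ - gridMass ε U`,
  -- so at most the share of `U` is left for `U`. Since `U ≠ 0`, the remainder eventually has mass
  -- below `μ`, as the interpolation bound requires.
  have hEle : pairEnergy ε p q α β W U G ≤ gridMass ε U / μ * I := by
    have h1 := (hlim'.sub hE).sub ((hmlim.div_const μ).mul_const I)
    have h2 : I - 0 - (μ - gridMass ε U) / μ * I = gridMass ε U / μ * I := by
      field_simp; ring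
    rw [h2] at h1
    refine ge_of_tendsto h1 ?_
    filter_upwards [hmlim.eventually_lt_const (show μ - gridMass ε U < μ by linarith)] with n hn
    have h3 := (mass_mul_le_pairEnergy hε hp.1 hq.1 hα hβ hμ hlow ((hug (ns n)).sub hUG hε)
      hn.le).1
    simp only [Function.comp_apply]
    linarith
  -- An intermediate mass would make the interpolation inequality strict for `U`, contradicting
  -- `hEle`.
  have hUμ : gridMass ε U = μ := by
    by_contra hne
    exact absurd ((mass_mul_le_pairEnergy hε hp.1 hq.1 hα hβ hμ hlow hUG hUle).2 hUpos
      (lt_of_le_of_ne hUle hne)) (not_lt.2 hEle)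
  rw [hUμ, div_self hμ.ne', one_mul] at hEle
  have hmem : pairEnergy ε p q α β W U G ∈ pairEnergies ε p q α β W μ := ⟨U, G, hUG, hUμ, rfl⟩
  rwa [← le_antisymm hEle (hlow hmem)]

end GroundState

theorem theorem1p3 (ε p q α β : ℝ) (hε : 0 < ε) (hp : p ∈ Set.Ioo (2 : ℝ) 6)
    (hq : q ∈ Set.Ioo (2 : ℝ) 4) (hα : 0 < α) (hβ : 0 < β)
    (V : Set (Grid ε)) (hV : IsZ2Periodic ε V) (hne : V.Nonempty) :
    ∀ μ : ℝ, 0 < μ →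
      groundStateLevel ε p q α β V μ < 0 ∧ ∃ u : Grid ε → ℝ, IsGroundState ε p q α β V μ u := by
  intro μ hμ
  obtain ⟨W, hW, hVW⟩ := hV
  have hWne : W.Nonempty := by
    rw [hVW] at hne; exact image_nonempty.1 hne
  have hbdd := bddBelow_pairEnergies hε hp hq hα hβ W hμ
  obtain ⟨u₀, g₀, hug₀, hm₀, hE₀⟩ :=
    exists_pairEnergy_neg (p := p) hε hp.1 hq hα hβ hW hWne hμ
  have hneg : sInf (pairEnergies ε p q α β W μ) < 0 :=
    (csInf_le hbdd ⟨u₀, g₀, hug₀, hm₀, rfl⟩).trans_lt hE₀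
  obtain ⟨u, g, hug, hm, hE⟩ := exists_pairEnergy_eq_sInf hε hp hq hα hβ hW hμ
    ⟨_, u₀, g₀, hug₀, hm₀, rfl⟩ hneg
  have hu : u ∈ gridH1Mass ε μ := ⟨hug.isGridH1 hε, hm⟩
  -- Every competitor in `H¹` underlies a pair of the same mass and energy, so the minimizer among
  -- pairs also attains the extended-real infimum.
  have hlevel : groundStateLevel ε p q α β V μ = (gridEnergy ε p q α β V u : EReal) := by
    refine le_antisymm (iInf₂_le u hu) (le_iInf₂ fun v hv => ?_)
    obtain ⟨k, hvk⟩ := hv.1.exists_gridPair hε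
    rw [EReal.coe_le_coe_iff, hug.gridEnergy_eq hε hq.1.le hVW, hvk.gridEnergy_eq hε hq.1.le hVW, hE]
    exact csInf_le hbdd ⟨v, k, hvk, hv.2, rfl⟩
  refine ⟨?_, u, hu, hlevel.symm⟩
  rw [hlevel, hug.gridEnergy_eq hε hq.1.le hVW, hE]
  exact_mod_cast hneg
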